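/- Let $K$ be a non-archimedean local field of characteristic $0$, with ring of integers $\mathcal O_K$, maximal ideal $\mathfrak m_K$ and residue characteristic $p$. Let $d\in K$ be a non-square, and let $E_d$ be the Edwards curve $\hat x^2+\hat y^2=1+d\,\hat x^2\hat y^2$. Let $J^0_K(E_d)$ be the set of affine $K$-points of $E_d$ (a point $P$ standing for the divisor class of $P-O$), which is an abelian group with neutral element $O=(0,1)$ under $$(x_P,y_P)+(x_Q,y_Q)=\left(\frac{x_Py_Q+x_Qy_P}{1+d\,x_Px_Qy_Py_Q},\ \frac{y_Py_Q-x_Px_Q}{1-d\,x_Px_Qy_Py_Q}\right).$$ Let $x_1,y_1\in K$ with $x_1\neq 0$ and $y_1^2=\frac{4x_1^3}{1-d}$. Put $a'=2x_1\frac{1+d}{1-d}$, $b'=x_1^2$, $a=b'-\frac{a'^2}{3}$, $b=\frac{2a'^3}{27}-\frac{a'b'}{3}$, $g_2=-4a$, $g_3=-4b$, and let $$\wp(z)=\frac1{z^2}+\sum_{k\ge2}c_kz^{2k-2},\qquad \wp'(z)=-\frac2{z^3}+\sum_{k\ge2}(2k-2)c_kz^{2k-3},$$ where $c_2=\frac{g_2}{20}$,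 $c_3=\frac{g_3}{28}$ and $c_k=\frac{3}{(2k+1)(k-3)}\sum_{m=2}^{k-2}c_mc_{k-m}$ for $k\ge4$. We say that the two series converge at $z\in K$ if $\sum_{k\ge2}c_kz^{2k-2}$ and $\sum_{k\ge2}(2k-2)c_kz^{2k-3}$ converge in $K$. **(1)** Let $I\subseteq\mathfrak m_K$ be an ideal of $\mathcal O_K$ such that the two series converge at every $z\in I$; one may take $I=\mathfrak m_K$ whenever they converge on $\mathfrak m_K$. Then for all $0\ne z\in I$ one has $\wp'(z)\ne0$, $3\wp(z)-a'+3x_1\neq0$ and $\left(\tfrac12\wp'(z)\right)^2=\wp(z)^3+a\,\wp(z)+b$. The map $$\mathrm{Exp}\colon I\to J^0_K(E_d),\qquad 0\mapsto O,\qquad z\mapsto\left(\frac23\,\frac{y_1(3\wp(z)-a')}{x_1\wp'(z)},\ \frac{3\wp(z)-a'-3x_1}{3\wp(z)-a'+3x_1}\right)\quad(z\ne0),$$ is well defined and is an injective group homomorphism; in particular $\mathrm{Exp}(z_1+z_2)=\mathrm{Exp}(z_1)+\mathrm{Exp}(z_2)$ for all $z_1,z_2\in I$. For $z\neq0$ it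 equals $\beta\bigl(\chi(\wp(z),\tfrac12\wp'(z))\bigr)$, where $\chi(x,y)=\left(x-\frac{a'}3,y\right)$ and $\beta(x,y)=\left(\frac{y_1x}{x_1y},\frac{x-x_1}{x+x_1}\right)$. **(2)** There is an integer $n\ge1$ such that the two series converge at every $z\in\mathfrak m_K^n$. **(3)** The two series converge at every $z\in\mathfrak m_K$ if $E_d$ has non-singular reduction in the sense that $d$ and $1-d$ are units of $\mathcal O_K$, and moreover $x_1\in\mathcal O_K$ and $p\notin\mathfrak m_K^{\,p-1}$ (that is, the absolute ramification index of $K$ is less than $p-1$; for instance $K=\mathbb Q_p$ with $p$ odd). In that case (1) holds with $I=\mathfrak m_K$. -/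

import Mathlib

open ValuativeRel

/-- An affine `K`-rational point of the Edwards curve `x² + y² = 1 + d x² y²`. -/
@[ext]
structure EdwardsPoint {K : Type*} [Field K] (d : K) where
  x : K
  y : K
  on_curve : x ^ 2 + y ^ 2 = 1 + d * x ^ 2 * y ^ 2

namespace EdwardsPoint

section Group

variable {K : Type*} [Field K] {d : K}

/-- If `d` is not a square, then `d x_P x_Q y_P y_Q` is never `1` or `-1`. -/
theorem sq_ne_one [h2 : NeZero (2 : K)] [hd : Fact (¬ IsSquare d)] (P Q : EdwardsPoint d) :
    (d * P.x * Q.x * P.y * Q.y) ^ 2 ≠ 1 := by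
  obtain ⟨x, y, h1⟩ := P
  obtain ⟨u, v, h3⟩ := Q
  intro he
  dsimp only at he
  have k1 : d * (x * y * (u + v)) ^ 2 = (x + (d * x * u * y * v) * y) ^ 2 := by
    linear_combination (d * x ^ 2 * y ^ 2) * h3 - h1 + (1 - y ^ 2) * he
  have k2 : d * (x * y * (u - v)) ^ 2 = (x - (d * x * u * y * v) * y) ^ 2 := by
    linear_combination (d * x ^ 2 * y ^ 2) * h3 - h1 + (1 - y ^ 2) * he
  have hx : x ≠ 0 := by rintro rfl; simp at he
  have hy : y ≠ 0 := by rintro rfl; simp at he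
  have hu : u ≠ 0 := by rintro rfl; simp at he
  have sq : ∀ a b : K, a ≠ 0 → d * a ^ 2 = b ^ 2 → False := by
    intro a b ha hab
    refine hd.out ⟨b / a, ?_⟩
    field_simp
    exact hab
  by_cases hp : u + v = 0
  · have hm : u - v ≠ 0 := by
      intro hm
      have : 2 * u = 0 := by linear_combination hp + hm
      exact (mul_ne_zero h2.out hu) this
    exact sq _ _ (mul_ne_zero (mul_ne_zero hx hy) hm) k2
  · exact sq _ _ (mul_ne_zero (mul_ne_zero hx hy) hp) k1

theorem one_add_ne_zero [NeZero (2 : K)] [Fact (¬ IsSquare d)] (P Q : EdwardsPoint d) :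
    1 + d * P.x * Q.x * P.y * Q.y ≠ 0 := fun h =>
  sq_ne_one P Q (by linear_combination (d * P.x * Q.x * P.y * Q.y - 1) * h)

theorem one_sub_ne_zero [NeZero (2 : K)] [Fact (¬ IsSquare d)] (P Q : EdwardsPoint d) :
    1 - d * P.x * Q.x * P.y * Q.y ≠ 0 := fun h =>
  sq_ne_one P Q (by linear_combination (-(d * P.x * Q.x * P.y * Q.y) - 1) * h)

/-- The neutral point `O = (0, 1)`. -/
instance : Zero (EdwardsPoint d) := ⟨⟨0, 1, by ring⟩⟩

/-- The opposite point: reflection in the `y`-axis. -/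
instance : Neg (EdwardsPoint d) := ⟨fun P => ⟨-P.x, P.y, by linear_combination P.on_curve⟩⟩

theorem zero_x : (0 : EdwardsPoint d).x = 0 := rfl

theorem zero_y : (0 : EdwardsPoint d).y = 1 := rfl

theorem neg_x (P : EdwardsPoint d) : (-P).x = -P.x := rfl

theorem neg_y (P : EdwardsPoint d) : (-P).y = P.y := rfl

/-- The Edwards addition law; it is complete because `d` is not a square. -/
instance [NeZero (2 : K)] [Fact (¬ IsSquare d)] : Add (EdwardsPoint d) :=
  ⟨fun P Q =>
    ⟨(P.x * Q.y + Q.x * P.y) / (1 + d * P.x * Q.x * P.y * Q.y),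
     (P.y * Q.y - P.x * Q.x) / (1 - d * P.x * Q.x * P.y * Q.y), by
      have hp := one_add_ne_zero P Q
      have hm := one_sub_ne_zero P Q
      obtain ⟨x, y, h1⟩ := P
      obtain ⟨u, v, h3⟩ := Q
      dsimp only at hp hm ⊢
      generalize hA : 1 + d * x * u * y * v = A at *
      generalize hB : 1 - d * x * u * y * v = B at *
      field_simp
      clear hp hm
      subst hA hB
      grind⟩⟩

variable [NeZero (2 : K)] [Fact (¬ IsSquare d)]

theorem add_x (P Q : EdwardsPoint d) :
    (P + Q).x = (P.x * Q.y + Q.x * P.y) / (1 + d * P.x * Q.x * P.y * Q.y) := rfl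

theorem add_y (P Q : EdwardsPoint d) :
    (P + Q).y = (P.y * Q.y - P.x * Q.x) / (1 - d * P.x * Q.x * P.y * Q.y) := rfl

theorem add_comm' (P Q : EdwardsPoint d) : P + Q = Q + P := by
  ext
  · rw [add_x, add_x]; congr 1 <;> ring
  · rw [add_y, add_y]; congr 1 <;> ring

theorem zero_add' (P : EdwardsPoint d) : 0 + P = P := by
  ext
  · rw [add_x, zero_x, zero_y]; simp
  · rw [add_y, zero_x, zero_y]; simp

theorem neg_add' (P : EdwardsPoint d) : -P + P = 0 := by
  have h := one_sub_ne_zero (-P) P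
  ext
  · rw [add_x, neg_x, neg_y, zero_x, div_eq_zero_iff]; left; ring
  · rw [neg_x, neg_y] at h
    rw [add_y, neg_x, neg_y, zero_y, div_eq_one_iff_eq h]
    linear_combination P.on_curve

theorem add_assoc' (P Q R : EdwardsPoint d) : P + Q + R = P + (Q + R) := by
  have a1 := one_add_ne_zero P Q
  have a2 := one_sub_ne_zero P Q
  have a3 := one_add_ne_zero Q R
  have a4 := one_sub_ne_zero Q R
  have b1 := one_add_ne_zero (P + Q) R
  have b2 := one_sub_ne_zero (P + Q) R
  have b3 := one_add_ne_zero P (Q + R)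
  have b4 := one_sub_ne_zero P (Q + R)
  rw [add_x, add_y] at b1 b2 b3 b4
  have ex : (P + Q + R).x = (P + (Q + R)).x := by
    rw [add_x, add_x P (Q + R), add_x P Q, add_y P Q, add_x Q R, add_y Q R]
    rw [div_eq_div_iff b1 b3]
    obtain ⟨x, y, h1⟩ := P
    obtain ⟨u, v, h2⟩ := Q
    obtain ⟨s, t, h3⟩ := R
    dsimp only at *
    clear b1 b2 b3 b4
    generalize hA : 1 + d * x * u * y * v = A at *
    generalize hB : 1 - d * x * u * y * v = B at *
    generalize hC : 1 + d * u * s * v * t = C at *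
    generalize hD : 1 - d * u * s * v * t = D at *
    field_simp
    clear a1 a2 a3 a4
    subst hA hB hC hD
    grind
  have ey : (P + Q + R).y = (P + (Q + R)).y := by
    rw [add_y, add_y P (Q + R), add_x P Q, add_y P Q, add_x Q R, add_y Q R]
    rw [div_eq_div_iff b2 b4]
    obtain ⟨x, y, h1⟩ := P
    obtain ⟨u, v, h2⟩ := Q
    obtain ⟨s, t, h3⟩ := R
    dsimp only at *
    clear b1 b2 b3 b4
    generalize hA : 1 + d * x * u * y * v = A at *
    generalize hB : 1 - d * x * u * y * v = B at *
    generalize hC : 1 + d * u * s * v * t = C at *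
    generalize hD : 1 - d * u * s * v * t = D at *
    field_simp
    clear a1 a2 a3 a4
    subst hA hB hC hD
    grind
  exact EdwardsPoint.ext ex ey

instance : AddCommGroup (EdwardsPoint d) where
  add_assoc := add_assoc'
  zero_add := zero_add'
  add_zero P := (add_comm' P 0).trans (zero_add' P)
  neg_add_cancel := neg_add'
  add_comm := add_comm'
  nsmul := nsmulRec
  zsmul := zsmulRec

end Group
end EdwardsPoint

section Weierstrass

variable {K : Type*} [Field K]

/-- The coefficients `c_k` (`k ≥ 2`) of the Laurent expansion of `℘` with invariants `g₂`, `g₃`: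
`c_2 = g₂ / 20`, `c_3 = g₃ / 28` and
`c_k = 3 / ((2k + 1)(k - 3)) * ∑_{m = 2}^{k - 2} c_m c_{k - m}` for `k ≥ 4`. -/
def wpCoeff (g₂ g₃ : K) : ℕ → K
  | 0 => 0
  | 1 => 0
  | 2 => g₂ / 20
  | 3 => g₃ / 28
  | k + 4 => 3 / ((2 * ((k : K) + 4) + 1) * ((k : K) + 1)) *
      ∑ m : Fin (k + 1), wpCoeff g₂ g₃ (m + 2) * wpCoeff g₂ g₃ (k + 2 - m)
  decreasing_by all_goals omega

variable [TopologicalSpace K]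

/-- The Laurent series of `℘` and of `℘'` both converge at `z`. -/
def WpConvergesAt (g₂ g₃ z : K) : Prop :=
  Summable (fun k : ℕ => wpCoeff g₂ g₃ (k + 2) * z ^ (2 * k + 2)) ∧
  Summable (fun k : ℕ => (2 * (k : K) + 2) * wpCoeff g₂ g₃ (k + 2) * z ^ (2 * k + 1))

/-- `℘(z) = z⁻² + ∑_{k ≥ 2} c_k z^(2k - 2)` (the summation index is shifted by `2`). -/
noncomputable def wp (g₂ g₃ z : K) : K :=
  1 / z ^ 2 + ∑' k : ℕ, wpCoeff g₂ g₃ (k + 2) * z ^ (2 * k + 2)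

/-- `℘'(z) = -2 z⁻³ + ∑_{k ≥ 2} (2k - 2) c_k z^(2k - 3)` (the index is shifted by `2`). -/
noncomputable def wpDeriv (g₂ g₃ z : K) : K :=
  -2 / z ^ 3 + ∑' k : ℕ, (2 * (k : K) + 2) * wpCoeff g₂ g₃ (k + 2) * z ^ (2 * k + 1)

end Weierstrass

namespace Edwards

variable {K : Type*} [Field K]

/-- The coefficient `a'` of the model `y² = x³ + a' x² + b' x`. -/
def a' (d x₁ : K) : K := 2 * x₁ * ((1 + d) / (1 - d))

/-- The coefficient `b'` of the model `y² = x³ + a' x² + b' x`. -/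
def b' (_d x₁ : K) : K := x₁ ^ 2

/-- The coefficient `a` of the short model `y² = x³ + a x + b` of `y² = x³ + a' x² + b' x`. -/
def a (d x₁ : K) : K := b' d x₁ - a' d x₁ ^ 2 / 3

/-- The coefficient `b` of the short model `y² = x³ + a x + b` of `y² = x³ + a' x² + b' x`. -/
def b (d x₁ : K) : K := 2 * a' d x₁ ^ 3 / 27 - a' d x₁ * b' d x₁ / 3

/-- The invariant `g₂` with `a = -g₂ / 4`. -/
def g₂ (d x₁ : K) : K := -4 * a d x₁

/-- The invariant `g₃` with `b = -g₃ / 4`. -/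
def g₃ (d x₁ : K) : K := -4 * b d x₁

/-- The translation `χ` from the short model to `y² = x³ + a' x² + b' x`, on affine points. -/
def chi (d x₁ : K) (P : K × K) : K × K := (P.1 - a' d x₁ / 3, P.2)

/-- The rational map `β` from `y² = x³ + a' x² + b' x` to the Edwards curve,
on affine points `(x, y)` with `y ≠ 0` and `x ≠ -x₁`. -/
def beta (x₁ y₁ : K) (P : K × K) : K × K :=
  (y₁ * P.1 / (x₁ * P.2), (P.1 - x₁) / (P.1 + x₁))

variable [TopologicalSpace K]

/-- The Weierstrass function `℘` of the short model attached to `d` and `x₁`. -/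
noncomputable def p (d x₁ z : K) : K := wp (g₂ d x₁) (g₃ d x₁) z

/-- Its derivative `℘'`. -/
noncomputable def p' (d x₁ z : K) : K := wpDeriv (g₂ d x₁) (g₃ d x₁) z

/-- The exponential map `z ↦ (℘(z), ℘'(z) / 2)` of the short model, for `z ≠ 0`. -/
noncomputable def expW (d x₁ z : K) : K × K := (p d x₁ z, 1 / 2 * p' d x₁ z)

open Classical in
/-- The explicit exponential map in affine coordinates of the Edwards curve;
`0` is mapped to the neutral point `(0, 1)`. -/
noncomputable def expE (d x₁ y₁ z : K) : K × K :=
  if z = 0 then (0, 1) else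
    (2 / 3 * (y₁ * (3 * p d x₁ z - a' d x₁) / (x₁ * p' d x₁ z)),
      (3 * p d x₁ z - a' d x₁ - 3 * x₁) / (3 * p d x₁ z - a' d x₁ + 3 * x₁))

end Edwards

/-!
The exponential map is the parametrization of a Weierstrass model of the Edwards curve by the
functions `X = ℘ - a₂ / 3` and `Y = ℘' / 2`, followed by the birational map `β`. The complex proof
of the addition theorem is not available, and everything rests on the formal differential equation
`℘'' = 6 ℘² - g₂ / 2`, which is a restatement of the recursion for the coefficients `c_k`
(`evenSeries_ode`). It implies the equation of the curve (`wpDerivSeries_sq`).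

*Addition.* Fix `v ≠ 0` in a closed disc on which the series converge. As a function of `u`, the
translate `X(u + v)` has a Taylor expansion at `u = 0`, and translation is a ring homomorphism on
the power series that converge on the disc (`PowerSeries.taylorHom`). The abscissa of the sum of the
points at `u` and `v`, computed by the chord construction, is a power series in `u` as well
(`exists_chord_solution`). Both solve the same second order equation with the same initial values,
so they agree (`taylorShift_chord`, `absVal_add`). The algebraic identity `EdwardsPoint.ofModel_add`
turns the chord law into the Edwards law. The case `u = v`, not covered by chords, follows from
`-v = v + (-2 v)`.

*Why nothing degenerates.* As `d` is not a square, the model has no point with abscissa `-x₁`, and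
`(0, 0)` is its only affine point of order two. The latter is not a value of the exponential map
either: if `X(v) = 0`, then `X(u) X(u + v) = a₄` identically in `u`, whereas at `u = v` the left
side vanishes (`absVal_ne_zero`). So `Y` has no zeros. Injectivity is clear, since the second Edwards
coordinate `(X - x₁) / (X + x₁)` never takes the value `1`.

*Convergence.* In the coordinates `t = -X / Y` and `w = -1 / Y` at infinity the invariant vector
field is polynomial with coefficients that are integral in `a₂` and `a₄`. Hence the expansions of `t` and
`w` in `z` have Hurwitz coefficients: `n!` times the `n`-th coefficient is bounded as for an
integral model. Legendre's formula for `n!` then gives convergence for `|z| ^ (p - 1) < |p|` in the integral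
case, and on some smaller disc in general.
-/

/-! ### The Laurent series of the Weierstrass function and their differential equations -/

namespace WeierstrassSeries

open PowerSeries

variable {K : Type*} [Field K]

theorem coeff_ofNat_mul (m n : ℕ) [m.AtLeastTwo] (f : K⟦X⟧) :
    coeff n ((ofNat(m) : K⟦X⟧) * f) = ofNat(m) * coeff n f := by
  rw [← map_ofNat C m, coeff_C_mul]

theorem derivative_ofNat (m : ℕ) [m.AtLeastTwo] : d⁄dX K (ofNat(m) : K⟦X⟧) = 0 := by
  rw [← map_ofNat C m, derivative_C]

theorem coeff_X_mul_derivative (f : K⟦X⟧) (n : ℕ) :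
    coeff n (X * d⁄dX K f) = n * coeff n f := by
  cases n with
  | zero => simp
  | succ n => rw [coeff_succ_X_mul, coeff_derivative]; push_cast; ring

/-- The power series `∑_{k ≥ 0} c_{k + 2} Y ^ k`. -/
noncomputable def tail (g₂ g₃ : K) : K⟦X⟧ := mk fun k => wpCoeff g₂ g₃ (k + 2)

/-- The power series `1 + ∑_{k ≥ 2} c_k Y ^ k`, that is `z² ℘(z)` in the variable `Y = z²`. -/
noncomputable def evenSeries (g₂ g₃ : K) : K⟦X⟧ := 1 + X ^ 2 * tail g₂ g₃

/-- The power series of `z² ℘(z)`. -/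
noncomputable def wpSeries (g₂ g₃ : K) : K⟦X⟧ := expand 2 two_ne_zero (evenSeries g₂ g₃)

/-- The power series of `z³ ℘'(z)`. -/
noncomputable def wpDerivSeries (g₂ g₃ : K) : K⟦X⟧ :=
  X * d⁄dX K (wpSeries g₂ g₃) - 2 * wpSeries g₂ g₃

theorem coeff_tail_sq (g₂ g₃ : K) (k : ℕ) : coeff k (tail g₂ g₃ ^ 2) =
    ∑ m : Fin (k + 1), wpCoeff g₂ g₃ (m + 2) * wpCoeff g₂ g₃ (k + 2 - m) := by
  rw [pow_two, coeff_mul, Finset.Nat.sum_antidiagonal_eq_sum_range_succ_mk, Finset.sum_range]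
  refine Finset.sum_congr rfl fun m _ => ?_
  simp only [tail, coeff_mk]
  congr 2
  omega

/-- The recursion for the `c_k`, as the differential equation `℘'' = 6 ℘² - g₂ / 2` written in
the variable `Y = z²`. -/
theorem evenSeries_ode [CharZero K] (g₂ g₃ : K) :
    4 * (X * d⁄dX K (X * d⁄dX K (evenSeries g₂ g₃))) - 10 * (X * d⁄dX K (evenSeries g₂ g₃))
      + 6 * evenSeries g₂ g₃ = 6 * evenSeries g₂ g₃ ^ 2 - C (g₂ / 2) * X ^ 2 := by
  have hS : evenSeries g₂ g₃ ^ 2 = 1 + 2 * (X ^ 2 * tail g₂ g₃) + X ^ 4 * tail g₂ g₃ ^ 2 := by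
    rw [evenSeries]; ring
  rw [hS]
  ext n
  simp only [map_sub, map_add, coeff_ofNat_mul, coeff_X_mul_derivative, coeff_C_mul]
  rw [evenSeries]
  rcases n with _ | _ | n
  · simp
  · simp [coeff_X_pow_mul', coeff_one, coeff_X_pow]
  · rcases n with _ | _ | n
    · simp [coeff_X_pow_mul', coeff_one, coeff_X_pow, tail, wpCoeff]
      ring
    · simp [coeff_X_pow_mul', coeff_one, coeff_X_pow, tail, wpCoeff]
      ring
    · have e1 : coeff (n + 1 + 1 + 1 + 1) (X ^ 2 * tail g₂ g₃) = wpCoeff g₂ g₃ (n + 4) := by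
        rw [show n + 1 + 1 + 1 + 1 = (n + 2) + 2 by ring, coeff_X_pow_mul, tail, coeff_mk]
      have e2 : coeff (n + 1 + 1 + 1 + 1) (X ^ 4 * tail g₂ g₃ ^ 2) = coeff n (tail g₂ g₃ ^ 2) := by
        rw [show n + 1 + 1 + 1 + 1 = n + 4 by ring, coeff_X_pow_mul]
      simp only [map_add, e1, e2, coeff_one, coeff_X_pow]
      rw [coeff_tail_sq, wpCoeff]
      have n1 : (2 * ((n : K) + 4) + 1) ≠ 0 := by norm_cast
      have n2 : (n : K) + 1 ≠ 0 := by norm_cast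
      generalize ∑ m : Fin (n + 1), wpCoeff g₂ g₃ (m + 2) * wpCoeff g₂ g₃ (n + 2 - m) = s
      push_cast
      simp
      field_simp
      ring

theorem X_mul_derivative_expand (f : K⟦X⟧) :
    X * d⁄dX K (expand 2 two_ne_zero f) = 2 * expand 2 two_ne_zero (X * d⁄dX K f) := by
  ext n
  rw [coeff_ofNat_mul]
  rw [coeff_X_mul_derivative, coeff_expand, coeff_expand]
  split_ifs with h
  · obtain ⟨m, rfl⟩ := h
    rw [Nat.mul_div_cancel_left m two_pos, coeff_X_mul_derivative]; push_cast; ring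
  · simp

section Equations

variable (g₂ g₃ : K)

/-- The equation `(℘')' = 6 ℘² - g₂ / 2`, multiplied by `z⁴`. -/
theorem X_mul_derivative_wpDerivSeries [CharZero K] :
    X * d⁄dX K (wpDerivSeries g₂ g₃) =
      3 * wpDerivSeries g₂ g₃ + 6 * wpSeries g₂ g₃ ^ 2 - C (g₂ / 2) * X ^ 4 := by
  have h := congrArg (expand 2 two_ne_zero) (evenSeries_ode g₂ g₃)
  have h1 := X_mul_derivative_expand (evenSeries g₂ g₃)
  have h2 := X_mul_derivative_expand (X * d⁄dX K (evenSeries g₂ g₃))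
  simp only [map_add, map_sub, map_mul, map_pow, expand_X, expand_C, map_ofNat] at h h1 h2
  rw [← wpSeries] at h h1
  have h3 : X * d⁄dX K (X * d⁄dX K (wpSeries g₂ g₃)) =
      2 * (X * d⁄dX K ((X ^ 2 * expand 2 two_ne_zero (d⁄dX K (evenSeries g₂ g₃))))) := by
    rw [h1, Derivation.leibniz, derivative_ofNat]; simp only [smul_eq_mul]; ring
  simp only [wpDerivSeries, map_sub, Derivation.leibniz _ (2 : K⟦X⟧), derivative_ofNat, smul_eq_mul]
  linear_combination h3 + 2 * h2 + h - 5 * h1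

theorem X_mul_derivative_wpSeries :
    X * d⁄dX K (wpSeries g₂ g₃) = 2 * wpSeries g₂ g₃ + wpDerivSeries g₂ g₃ := by
  rw [wpDerivSeries]; ring

/-- The expansion with the two coefficients that are not determined by the recursion. -/
theorem exists_wpSeries_eq : ∃ R : K⟦X⟧, wpSeries g₂ g₃ =
    1 + C (g₂ / 20) * X ^ 4 + C (g₃ / 28) * X ^ 6 + X ^ 8 * R := by
  have : tail g₂ g₃ = C (g₂ / 20) + C (g₃ / 28) * X +
      X ^ 2 * mk fun k => wpCoeff g₂ g₃ (k + 4) := by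
    ext n
    rcases n with _ | _ | n
    · simp [tail, wpCoeff]
    · simp [tail, wpCoeff, coeff_X_pow_mul', coeff_C]
    · simp [tail, coeff_X_pow_mul']
  refine ⟨expand 2 two_ne_zero (mk fun k => wpCoeff g₂ g₃ (k + 4)), ?_⟩
  rw [wpSeries, evenSeries, this]
  simp only [map_add, map_mul, map_pow, expand_X, expand_C, map_one]
  ring

theorem exists_wpDerivSeries_eq : ∃ R : K⟦X⟧, wpDerivSeries g₂ g₃ =
    -2 + 2 * C (g₂ / 20) * X ^ 4 + 4 * C (g₃ / 28) * X ^ 6 + X ^ 8 * R := by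
  obtain ⟨R, hR⟩ := exists_wpSeries_eq g₂ g₃
  refine ⟨6 * R + X * d⁄dX K R, ?_⟩
  have : ∀ n : ℕ, d⁄dX K (X ^ (n + 1)) = (n + 1 : K⟦X⟧) * X ^ n := by
    intro n; rw [derivative_pow]; simp
  rw [wpDerivSeries, hR]
  simp only [map_add, Derivation.leibniz, this, derivative_C, smul_eq_mul, derivative_one]
  push_cast
  ring

/-- The equation `℘'² = 4 ℘³ - g₂ ℘ - g₃`, multiplied by `z⁶`. The difference `E` of the two sides
satisfies `X E' = 6 E`, so that only its coefficient of degree `6` has to be computed. -/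
theorem wpDerivSeries_sq [CharZero K] : wpDerivSeries g₂ g₃ ^ 2 =
    4 * wpSeries g₂ g₃ ^ 3 - C g₂ * X ^ 4 * wpSeries g₂ g₃ - C g₃ * X ^ 6 := by
  obtain ⟨R, hR⟩ := exists_wpSeries_eq g₂ g₃
  obtain ⟨R', hR'⟩ := exists_wpDerivSeries_eq g₂ g₃
  have hP := X_mul_derivative_wpSeries g₂ g₃
  have hQ := X_mul_derivative_wpDerivSeries g₂ g₃
  set P := wpSeries g₂ g₃
  set Q := wpDerivSeries g₂ g₃
  have h20 : C g₂ = 20 * C (g₂ / 20) := by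
    rw [← map_ofNat C 20, ← map_mul]; congr 1; field_simp
  have h22 : C g₂ = 2 * C (g₂ / 2) := by
    rw [← map_ofNat C 2, ← map_mul]; congr 1; field_simp
  have h28 : C g₃ = 28 * C (g₃ / 28) := by
    rw [← map_ofNat C 28, ← map_mul]; congr 1; field_simp
  set A := C (g₂ / 20)
  set B := C (g₃ / 28)
  set E := Q ^ 2 - 4 * P ^ 3 + C g₂ * X ^ 4 * P + C g₃ * X ^ 6 with hE
  have hXE : X * d⁄dX K E = 6 * E := by
    simp only [hE, map_add, map_sub, Derivation.leibniz, derivative_pow, derivative_C,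
      derivative_ofNat, smul_eq_mul, derivative_X]
    push_cast
    linear_combination 2 * Q * hQ + (-12 * P ^ 2 + C g₂ * X ^ 4) * hP + Q * X ^ 4 * h22
  have hcoeff : ∀ n : ℕ, n ≠ 6 → coeff n E = 0 := by
    intro n hn
    have := congrArg (coeff n) hXE
    rw [coeff_ofNat_mul] at this
    rcases n with _ | n
    · simpa using this
    · rw [coeff_succ_X_mul, coeff_derivative] at this
      have h6 : (n : K) + 1 - 6 ≠ 0 := by
        rw [sub_ne_zero]; exact_mod_cast hn
      exact (mul_eq_zero.mp (show ((n : K) + 1 - 6) * coeff (n + 1) E = 0 by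
        linear_combination this)).resolve_left h6
  -- the recursion leaves `c₃` free in degree `6`, where the value `g₃ / 28` gives cancellation
  have hE8 : ∃ F : K⟦X⟧, E = X ^ 8 * F := by
    refine ⟨-4 * R' + (2 * A + 4 * B * X ^ 2 + X ^ 4 * R') ^ 2 - 12 * R
      - 12 * (A + B * X ^ 2 + X ^ 4 * R) ^ 2 - 4 * X ^ 4 * (A + B * X ^ 2 + X ^ 4 * R) ^ 3
      + 20 * A * (A + B * X ^ 2 + X ^ 4 * R), ?_⟩
    rw [hE, hR, hR', h20, h28]
    ring
  have hE0 : E = 0 := by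
    ext n
    by_cases hn : n = 6
    · obtain ⟨F, hF⟩ := hE8
      rw [hF, hn, coeff_X_pow_mul']; simp
    · rw [hcoeff n hn]; simp
  linear_combination hE0

end Equations

end WeierstrassSeries

/-! ### Growth of the coefficients -/

namespace WeierstrassSeries

open PowerSeries
open scoped Nat

section Model

variable {K : Type*} [Field K] (a₂ a₄ : K)

/-- The invariant `g₂` of the short Weierstrass model of `y² = x³ + a₂ x² + a₄ x`. -/
def modelG₂ : K := -4 * (a₄ - a₂ ^ 2 / 3)

/-- The invariant `g₃` of the short Weierstrass model of `y² = x³ + a₂ x² + a₄ x`. -/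
def modelG₃ : K := -4 * (2 * a₂ ^ 3 / 27 - a₂ * a₄ / 3)

/-- The power series of `z² X(z)`, where `X = ℘ - a₂ / 3` is the abscissa on the model
`y² = x³ + a₂ x² + a₄ x`. -/
noncomputable def absSeries : K⟦X⟧ :=
  wpSeries (modelG₂ a₂ a₄) (modelG₃ a₂ a₄) - C (a₂ / 3) * X ^ 2

/-- The power series of `2 z³ Y(z)`, where `Y = ℘' / 2` is the ordinate on the model
`y² = x³ + a₂ x² + a₄ x`. -/
noncomputable def ordSeries : K⟦X⟧ := wpDerivSeries (modelG₂ a₂ a₄) (modelG₃ a₂ a₄)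

theorem X_mul_derivative_absSeries :
    X * d⁄dX K (absSeries a₂ a₄) = 2 * absSeries a₂ a₄ + ordSeries a₂ a₄ := by
  have h := X_mul_derivative_wpSeries (modelG₂ a₂ a₄) (modelG₃ a₂ a₄)
  simp only [absSeries, ordSeries, map_sub, Derivation.leibniz, derivative_C, derivative_pow,
    derivative_X, smul_eq_mul]
  push_cast
  linear_combination h

theorem constantCoeff_ofNat (m : ℕ) [m.AtLeastTwo] :
    constantCoeff (ofNat(m) : K⟦X⟧) = ofNat(m) := map_ofNat _ m

theorem constantCoeff_ordSeries : constantCoeff (ordSeries a₂ a₄) = -2 := by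
  obtain ⟨R, hR⟩ := exists_wpDerivSeries_eq (modelG₂ a₂ a₄) (modelG₃ a₂ a₄)
  rw [ordSeries, hR]
  simp [constantCoeff_ofNat]

theorem constantCoeff_absSeries : constantCoeff (absSeries a₂ a₄) = 1 := by
  obtain ⟨R, hR⟩ := exists_wpSeries_eq (modelG₂ a₂ a₄) (modelG₃ a₂ a₄)
  rw [absSeries, hR]; simp

/-- The power series of the local parameter `t = -X / Y` at infinity. -/
noncomputable def tSeries : K⟦X⟧ := -2 * X * absSeries a₂ a₄ * (ordSeries a₂ a₄)⁻¹

/-- The power series of the function `w = -1 / Y`. -/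
noncomputable def wSeries : K⟦X⟧ := -2 * X ^ 3 * (ordSeries a₂ a₄)⁻¹

/-- The power series of `t(z) / z`. -/
noncomputable def tDivSeries : K⟦X⟧ := -2 * absSeries a₂ a₄ * (ordSeries a₂ a₄)⁻¹

theorem X_mul_tDivSeries : X * tDivSeries a₂ a₄ = tSeries a₂ a₄ := by
  rw [tDivSeries, tSeries]; ring

variable [CharZero K]

theorem C_eq_three_mul : C a₂ = 3 * C (a₂ / 3) := by
  rw [← map_ofNat C 3, ← map_mul]; congr 1; field_simp

theorem X_mul_derivative_ordSeries : X * d⁄dX K (ordSeries a₂ a₄) = 3 * ordSeries a₂ a₄ +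
    6 * absSeries a₂ a₄ ^ 2 + 4 * C a₂ * X ^ 2 * absSeries a₂ a₄ + 2 * C a₄ * X ^ 4 := by
  have h := X_mul_derivative_wpDerivSeries (modelG₂ a₂ a₄) (modelG₃ a₂ a₄)
  have hg : C (modelG₂ a₂ a₄ / 2) = 6 * C (a₂ / 3) ^ 2 - 2 * C a₄ := by
    rw [← map_ofNat C 6, ← map_ofNat C 2, ← map_pow, ← map_mul, ← map_mul, ← map_sub, modelG₂]
    congr 1; field_simp; ring
  rw [ordSeries, h, absSeries, C_eq_three_mul a₂, hg]
  ring

theorem ordSeries_sq : ordSeries a₂ a₄ ^ 2 = 4 * (absSeries a₂ a₄ ^ 3 +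
    C a₂ * X ^ 2 * absSeries a₂ a₄ ^ 2 + C a₄ * X ^ 4 * absSeries a₂ a₄) := by
  have h := wpDerivSeries_sq (modelG₂ a₂ a₄) (modelG₃ a₂ a₄)
  have hg : C (modelG₂ a₂ a₄) = 12 * C (a₂ / 3) ^ 2 - 4 * C a₄ := by
    rw [← map_ofNat C 12, ← map_ofNat C 4, ← map_pow, ← map_mul, ← map_mul, ← map_sub, modelG₂]
    congr 1; field_simp; ring
  have hg' : C (modelG₃ a₂ a₄) = 4 * C (a₂ / 3) * C a₄ - 8 * C (a₂ / 3) ^ 3 := by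
    rw [← map_ofNat C 4, ← map_ofNat C 8, ← map_pow, ← map_mul, ← map_mul, ← map_mul, ← map_sub,
      modelG₃]
    congr 1; field_simp; ring
  rw [ordSeries, h, absSeries, C_eq_three_mul a₂, hg, hg']
  ring

theorem ordSeries_mul_inv : ordSeries a₂ a₄ * (ordSeries a₂ a₄)⁻¹ = 1 :=
  PowerSeries.mul_inv_cancel _ (by rw [constantCoeff_ordSeries]; norm_num)

/-- Together with `derivative_wSeries`: the invariant vector field is polynomial, with integral
coefficients, in the coordinates `t` and `w`. -/
theorem derivative_tSeries : d⁄dX K (tSeries a₂ a₄) =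
    1 - C a₂ * tSeries a₂ a₄ ^ 2 - 2 * C a₄ * (tSeries a₂ a₄ * wSeries a₂ a₄) := by
  have hP := X_mul_derivative_absSeries a₂ a₄
  have hQ := X_mul_derivative_ordSeries a₂ a₄
  have hE := ordSeries_sq a₂ a₄
  have hI := ordSeries_mul_inv a₂ a₄
  rw [tSeries, wSeries]
  refine mul_left_cancel₀ (X_ne_zero (R := K)) ?_
  simp only [Derivation.leibniz, map_neg, derivative_inv', derivative_ofNat, derivative_X,
    smul_eq_mul]
  generalize absSeries a₂ a₄ = P at *
  generalize ordSeries a₂ a₄ = Q at *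
  generalize Q⁻¹ = I at *
  linear_combination -2 * X * I * hP + 2 * X * P * I ^ 2 * hQ +
    (6 * X * P * I - 2 * X + 3 * X * (Q * I + 1)) * hI - 3 * X * I ^ 2 * hE

theorem derivative_wSeries : d⁄dX K (wSeries a₂ a₄) = 3 * tSeries a₂ a₄ ^ 2 +
    2 * C a₂ * (tSeries a₂ a₄ * wSeries a₂ a₄) + C a₄ * wSeries a₂ a₄ ^ 2 := by
  have hQ := X_mul_derivative_ordSeries a₂ a₄
  have hI := ordSeries_mul_inv a₂ a₄
  rw [tSeries, wSeries]
  refine mul_left_cancel₀ (X_ne_zero (R := K)) ?_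
  simp only [Derivation.leibniz, map_neg, derivative_inv', derivative_ofNat, derivative_X,
    derivative_pow, smul_eq_mul]
  generalize absSeries a₂ a₄ = P at *
  generalize ordSeries a₂ a₄ = Q at *
  generalize Q⁻¹ = I at *
  push_cast
  linear_combination 2 * X ^ 3 * I ^ 2 * hQ + 6 * X ^ 3 * I * hI

theorem constantCoeff_tDivSeries : constantCoeff (tDivSeries a₂ a₄) = 1 := by
  rw [tDivSeries]
  simp [constantCoeff_absSeries, constantCoeff_ordSeries, constantCoeff_ofNat]

/-- The equation of the model, as a formula for `X` in terms of the coordinates `t` and `w`. -/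
theorem absSeries_mul_tDivSeries_sq : absSeries a₂ a₄ * tDivSeries a₂ a₄ ^ 2 =
    1 - C a₂ * tSeries a₂ a₄ ^ 2 - C a₄ * (tSeries a₂ a₄ * wSeries a₂ a₄) := by
  have hE := ordSeries_sq a₂ a₄
  have hI := ordSeries_mul_inv a₂ a₄
  rw [tSeries, wSeries, tDivSeries]
  generalize absSeries a₂ a₄ = P at *
  generalize ordSeries a₂ a₄ = Q at *
  generalize Q⁻¹ = I at *
  linear_combination -I ^ 2 * hE + (Q * I + 1) * hI

end Model

theorem coeff_wpSeries {K : Type*} [Field K] (g₂ g₃ : K) (k : ℕ) :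
    coeff (2 * k + 4) (wpSeries g₂ g₃) = wpCoeff g₂ g₃ (k + 2) := by
  rw [wpSeries, show 2 * k + 4 = 2 * (k + 2) by ring, coeff_expand_mul, evenSeries, map_add,
    coeff_X_pow_mul, coeff_one, tail, coeff_mk]
  simp

section Norm

variable {K : Type*} [NormedField K] [IsUltrametricDist K]

/-- Bounds on the divided-power coefficients `n! f_n` are multiplicative, because the structure
constants of the product are binomial coefficients. -/
theorem norm_factorial_mul_coeff_mul_le {f g : K⟦X⟧} {c d μ : ℝ} (hc : 0 ≤ c) (hd : 0 ≤ d)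
    (hμ : 0 ≤ μ) {N : ℕ} (hf : ∀ n ≤ N, ‖(n ! : K) * coeff n f‖ ≤ c * μ ^ n)
    (hg : ∀ n ≤ N, ‖(n ! : K) * coeff n g‖ ≤ d * μ ^ n) :
    ∀ n ≤ N, ‖(n ! : K) * coeff n (f * g)‖ ≤ c * d * μ ^ n := by
  intro n hn
  rw [coeff_mul, Finset.mul_sum]
  refine IsUltrametricDist.norm_sum_le_of_forall_le_of_nonneg (by positivity) fun ij hij => ?_
  obtain ⟨i, j⟩ := ij
  rw [Finset.HasAntidiagonal.mem_antidiagonal] at hij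
  dsimp only at hij ⊢
  subst hij
  have : ((i + j)! : K) = ((i + j).choose i : K) * (i ! : K) * (j ! : K) := by
    rw [Nat.choose_symm_add, ← Nat.add_choose_mul_factorial_mul_factorial i j]
    push_cast
    rfl
  calc ‖((i + j)! : K) * (coeff i f * coeff j g)‖
      = ‖((i + j).choose i : K)‖ * (‖(i ! : K) * coeff i f‖ * ‖(j ! : K) * coeff j g‖) := by
        rw [this, ← norm_mul, ← norm_mul]; congr 1; ring
    _ ≤ 1 * ((c * μ ^ i) * (d * μ ^ j)) := by
        gcongr
        · exact IsUltrametricDist.norm_natCast_le_one K _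
        · exact hf i (by omega)
        · exact hg j (by omega)
    _ = c * d * μ ^ (i + j) := by ring

theorem norm_sub_le_max_norm (x y : K) : ‖x - y‖ ≤ max ‖x‖ ‖y‖ := by
  rw [sub_eq_add_neg, ← norm_neg y]
  exact IsUltrametricDist.norm_add_le_max x (-y)

/-- Division by a series with constant term `1` preserves bounds of geometric type. -/
theorem norm_coeff_le_of_mul_eq {f g h : K⟦X⟧} {r : ℝ} (hr : 0 ≤ r) (hfg : f * g = h)
    (hg0 : constantCoeff g = 1) (hg : ∀ n, ‖coeff n g‖ ≤ r ^ n) (hh : ∀ n, ‖coeff n h‖ ≤ r ^ n) :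
    ∀ n, ‖coeff n f‖ ≤ r ^ n := by
  intro n
  induction n using Nat.strong_induction_on with
  | _ n ih =>
    have e : coeff n f = coeff n h -
        ∑ ij ∈ (Finset.HasAntidiagonal.antidiagonal n).erase (n, 0),
          coeff ij.1 f * coeff ij.2 g := by
      rw [← hfg, coeff_mul, ← Finset.add_sum_erase _ _
        (show (n, 0) ∈ Finset.HasAntidiagonal.antidiagonal n by simp)]
      simp [hg0]
    rw [e]
    refine (norm_sub_le_max_norm _ _).trans (max_le (hh n) ?_)
    refine IsUltrametricDist.norm_sum_le_of_forall_le_of_nonneg (by positivity) fun ij hij => ?_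
    obtain ⟨i, j⟩ := ij
    rw [Finset.mem_erase, Finset.HasAntidiagonal.mem_antidiagonal] at hij
    dsimp only at hij ⊢
    have hij2 : i < n := by
      rcases Nat.eq_zero_or_pos j with hj | hj
      · subst hj; exact absurd (by rw [← hij.2]; simp) hij.1
      · omega
    rw [norm_mul, ← hij.2, pow_add]
    gcongr
    · exact ih i hij2
    · exact hg j

variable [CharZero K] {a₂ a₄ : K} {μ ρ : ℝ}

/-- Hurwitz integrality of the expansions of `t` and `w` in the invariant parameter `z`: the
differential equations have integral coefficients, so `n!` clears the denominators of the `n`-th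
coefficients. The number `μ` is a weight of homogeneity, which makes room for models that are not
integral. -/
theorem norm_factorial_mul_coeff_tSeries_le (hμ : 0 < μ) (h₂ : ‖a₂‖ ≤ μ ^ 2) (h₄ : ‖a₄‖ ≤ μ ^ 4)
    (N : ℕ) : (∀ n ≤ N, ‖(n ! : K) * coeff n (tSeries a₂ a₄)‖ ≤ μ⁻¹ * μ ^ n) ∧
      (∀ n ≤ N, ‖(n ! : K) * coeff n (wSeries a₂ a₄)‖ ≤ μ⁻¹ ^ 3 * μ ^ n) := by
  have hμ0 := hμ.ne'
  induction N with
  | zero =>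
    refine ⟨fun n hn => ?_, fun n hn => ?_⟩ <;> obtain rfl := Nat.le_zero.mp hn
    · rw [tSeries]; simp; positivity
    · rw [wSeries]; simp; positivity
  | succ N ih =>
    obtain ⟨ht, hw⟩ := ih
    have hi : 0 ≤ μ⁻¹ := by positivity
    have hi3 : 0 ≤ μ⁻¹ ^ 3 := by positivity
    have htt := norm_factorial_mul_coeff_mul_le hi hi hμ.le ht ht N le_rfl
    have htw := norm_factorial_mul_coeff_mul_le hi hi3 hμ.le ht hw N le_rfl
    have hww := norm_factorial_mul_coeff_mul_le hi3 hi3 hμ.le hw hw N le_rfl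
    rw [← pow_two] at htt hww
    have hstep : ∀ f : K⟦X⟧, ((N + 1)! : K) * coeff (N + 1) f = (N ! : K) * coeff N (d⁄dX K f) := by
      intro f
      rw [coeff_derivative, Nat.factorial_succ]; push_cast; ring
    have h2 : ‖(2 : K)‖ ≤ 1 := by exact_mod_cast IsUltrametricDist.norm_natCast_le_one K 2
    have h3 : ‖(3 : K)‖ ≤ 1 := by exact_mod_cast IsUltrametricDist.norm_natCast_le_one K 3
    refine ⟨fun n hn => ?_, fun n hn => ?_⟩
    · rcases Nat.le_add_one_iff.mp hn with hn | rfl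
      · exact ht n hn
      rw [hstep, derivative_tSeries, mul_assoc, map_sub, map_sub, coeff_C_mul, coeff_ofNat_mul,
        coeff_C_mul, mul_sub, mul_sub]
      refine (norm_sub_le_max_norm _ _).trans (max_le
        ((norm_sub_le_max_norm _ _).trans (max_le ?_ ?_)) ?_)
      · rw [coeff_one]
        split_ifs with h
        · subst h; simp [hμ0]
        · simp; positivity
      · rw [mul_left_comm, norm_mul]
        refine (mul_le_mul h₂ htt (norm_nonneg _) (by positivity)).trans (le_of_eq ?_)
        field_simp
        ring
      · rw [show ∀ x : K, (N ! : K) * (2 * (a₄ * x)) = 2 * (a₄ * ((N ! : K) * x)) by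
          intro x; ring, norm_mul, norm_mul]
        refine (mul_le_mul h2 (mul_le_mul h₄ htw (norm_nonneg _) (by positivity)) (by positivity)
          zero_le_one).trans (le_of_eq ?_)
        field_simp
        ring
    · rcases Nat.le_add_one_iff.mp hn with hn | rfl
      · exact hw n hn
      rw [hstep, derivative_wSeries, mul_assoc 2, map_add, map_add, coeff_ofNat_mul,
        coeff_ofNat_mul, coeff_C_mul, coeff_C_mul, mul_add, mul_add]
      refine (IsUltrametricDist.norm_add_le_max _ _).trans (max_le
        ((IsUltrametricDist.norm_add_le_max _ _).trans (max_le ?_ ?_)) ?_)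
      · rw [mul_left_comm, norm_mul]
        refine (mul_le_mul h3 htt (norm_nonneg _) zero_le_one).trans (le_of_eq ?_)
        field_simp
        ring
      · rw [show ∀ x : K, (N ! : K) * (2 * (a₂ * x)) = 2 * (a₂ * ((N ! : K) * x)) by
          intro x; ring, norm_mul, norm_mul]
        refine (mul_le_mul h2 (mul_le_mul h₂ htw (norm_nonneg _) (by positivity)) (by positivity)
          zero_le_one).trans (le_of_eq ?_)
        field_simp
        ring
      · rw [mul_left_comm, norm_mul]
        refine (mul_le_mul h₄ hww (norm_nonneg _) (by positivity)).trans (le_of_eq ?_)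
        field_simp
        ring

/-- The number `ρ` absorbs the growth of `1 / n!`. The hypothesis on it involves `(n + 1)!` in
degree `n` because the series of `t` is divided by `z`. -/
theorem norm_coeff_absSeries_le (hμ : 0 < μ) (h₂ : ‖a₂‖ ≤ μ ^ 2) (h₄ : ‖a₄‖ ≤ μ ^ 4)
    (hρ : 1 ≤ ρ) (hfac : ∀ n : ℕ, 1 ≤ ρ ^ n * ‖((n + 1)! : K)‖) (n : ℕ) :
    ‖coeff n (absSeries a₂ a₄)‖ ≤ (μ * ρ) ^ n := by
  have hμ0 := hμ.ne'
  have hρ0 : 0 < ρ := by linarith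
  have hi : 0 ≤ μ⁻¹ := by positivity
  have hi3 : 0 ≤ μ⁻¹ ^ 3 := by positivity
  have ht := fun n => (norm_factorial_mul_coeff_tSeries_le (K := K) hμ h₂ h₄ n).1
  have hw := fun n => (norm_factorial_mul_coeff_tSeries_le (K := K) hμ h₂ h₄ n).2
  have hfac' : ∀ n : ℕ, 1 ≤ ρ ^ n * ‖(n ! : K)‖ := by
    intro n
    rcases n with _ | n
    · simp
    · refine (hfac n).trans ?_
      refine mul_le_mul_of_nonneg_right (pow_le_pow_right₀ hρ n.le_succ) (norm_nonneg _)
  have hpass : ∀ (x : K) (n : ℕ), ‖(n ! : K) * x‖ ≤ μ ^ n → ‖x‖ ≤ (μ * ρ) ^ n := by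
    intro x n hx
    calc ‖x‖ ≤ (ρ ^ n * ‖(n ! : K)‖) * ‖x‖ := le_mul_of_one_le_left (norm_nonneg _) (hfac' n)
      _ = ρ ^ n * ‖(n ! : K) * x‖ := by rw [norm_mul]; ring
      _ ≤ ρ ^ n * μ ^ n := by gcongr
      _ = (μ * ρ) ^ n := by rw [mul_pow, mul_comm]
  have hs : ∀ n, ‖coeff n (tDivSeries a₂ a₄)‖ ≤ (μ * ρ) ^ n := by
    intro n
    have h := ht (n + 1) (n + 1) le_rfl
    rw [← X_mul_tDivSeries, coeff_succ_X_mul, pow_succ', inv_mul_cancel_left₀ hμ0] at h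
    calc ‖coeff n (tDivSeries a₂ a₄)‖
        ≤ (ρ ^ n * ‖((n + 1)! : K)‖) * ‖coeff n (tDivSeries a₂ a₄)‖ :=
          le_mul_of_one_le_left (norm_nonneg _) (hfac n)
      _ = ρ ^ n * ‖((n + 1)! : K) * coeff n (tDivSeries a₂ a₄)‖ := by rw [norm_mul]; ring
      _ ≤ ρ ^ n * μ ^ n := by gcongr
      _ = (μ * ρ) ^ n := by rw [mul_pow, mul_comm]
  have hr : 0 ≤ μ * ρ := by positivity
  refine norm_coeff_le_of_mul_eq hr (absSeries_mul_tDivSeries_sq a₂ a₄) ?_ ?_ ?_ n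
  · rw [map_pow, constantCoeff_tDivSeries, one_pow]
  · intro n
    rw [pow_two, coeff_mul]
    refine IsUltrametricDist.norm_sum_le_of_forall_le_of_nonneg (by positivity) fun ij hij => ?_
    rw [← Finset.HasAntidiagonal.mem_antidiagonal.mp hij, norm_mul, pow_add]
    gcongr
    · exact hs _
    · exact hs _
  · intro n
    have htt := norm_factorial_mul_coeff_mul_le hi hi hμ.le (ht n) (ht n) n le_rfl
    have htw := norm_factorial_mul_coeff_mul_le hi hi3 hμ.le (ht n) (hw n) n le_rfl
    rw [← pow_two] at htt
    rw [map_sub, map_sub, coeff_C_mul, coeff_C_mul]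
    refine (norm_sub_le_max_norm _ _).trans (max_le
      ((norm_sub_le_max_norm _ _).trans (max_le ?_ ?_)) ?_)
    · rw [coeff_one]
      split_ifs with h
      · subst h; simp
      · simp; positivity
    · refine hpass _ n ?_
      rw [mul_left_comm, norm_mul]
      refine (mul_le_mul h₂ htt (norm_nonneg _) (by positivity)).trans (le_of_eq ?_)
      field_simp
    · refine hpass _ n ?_
      rw [mul_left_comm, norm_mul]
      refine (mul_le_mul h₄ htw (norm_nonneg _) (by positivity)).trans (le_of_eq ?_)
      field_simp

theorem norm_wpCoeff_le (hμ : 0 < μ) (h₂ : ‖a₂‖ ≤ μ ^ 2) (h₄ : ‖a₄‖ ≤ μ ^ 4)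
    (hρ : 1 ≤ ρ) (hfac : ∀ n : ℕ, 1 ≤ ρ ^ n * ‖((n + 1)! : K)‖) (k : ℕ) :
    ‖wpCoeff (modelG₂ a₂ a₄) (modelG₃ a₂ a₄) (k + 2)‖ ≤ (μ * ρ) ^ (2 * k + 4) := by
  have := norm_coeff_absSeries_le hμ h₂ h₄ hρ hfac (2 * k + 4)
  rwa [absSeries, map_sub, coeff_wpSeries, coeff_C_mul, coeff_X_pow, if_neg (by omega), mul_zero,
    sub_zero] at this

theorem wpConvergesAt_of_norm_lt [CompleteSpace K] (hμ : 0 < μ) (h₂ : ‖a₂‖ ≤ μ ^ 2)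
    (h₄ : ‖a₄‖ ≤ μ ^ 4) (hρ : 1 ≤ ρ) (hfac : ∀ n : ℕ, 1 ≤ ρ ^ n * ‖((n + 1)! : K)‖) {z : K}
    (hz : μ * ρ * ‖z‖ < 1) : WpConvergesAt (modelG₂ a₂ a₄) (modelG₃ a₂ a₄) z := by
  have hr : 0 ≤ μ * ρ * ‖z‖ := by positivity
  have hlim : Filter.Tendsto (fun k : ℕ => (μ * ρ * ‖z‖) ^ (2 * k + 1)) Filter.atTop (nhds 0) :=
    (tendsto_pow_atTop_nhds_zero_of_lt_one hr hz).comp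
      (Filter.tendsto_atTop_mono (fun k => (by omega : k ≤ 2 * k + 1)) Filter.tendsto_id)
  have hlim' : Filter.Tendsto (fun k : ℕ => (μ * ρ * ‖z‖) ^ (2 * k + 2)) Filter.atTop (nhds 0) :=
    (tendsto_pow_atTop_nhds_zero_of_lt_one hr hz).comp
      (Filter.tendsto_atTop_mono (fun k => (by omega : k ≤ 2 * k + 2)) Filter.tendsto_id)
  constructor
  · refine NonarchimedeanAddGroup.summable_of_tendsto_cofinite_zero ?_
    rw [Nat.cofinite_eq_atTop]
    refine squeeze_zero_norm (fun k => ?_) (by simpa using hlim'.const_mul ((μ * ρ) ^ 2))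
    rw [norm_mul, norm_pow]
    refine (mul_le_mul_of_nonneg_right (norm_wpCoeff_le hμ h₂ h₄ hρ hfac k)
      (by positivity)).trans (le_of_eq ?_)
    ring
  · refine NonarchimedeanAddGroup.summable_of_tendsto_cofinite_zero ?_
    rw [Nat.cofinite_eq_atTop]
    refine squeeze_zero_norm (fun k => ?_) (by simpa using hlim.const_mul ((μ * ρ) ^ 3))
    rw [norm_mul, norm_mul, norm_pow]
    have h1 : ‖(2 * (k : K) + 2)‖ ≤ 1 := by
      exact_mod_cast IsUltrametricDist.norm_natCast_le_one K (2 * k + 2)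
    refine (mul_le_mul_of_nonneg_right (mul_le_mul h1 (norm_wpCoeff_le hμ h₂ h₄ hρ hfac k)
      (norm_nonneg _) zero_le_one) (by positivity)).trans (le_of_eq ?_)
    ring

/-- Legendre's formula for `n!` as a lower bound on its norm, with `ρ ^ (p - 1) = ‖p‖⁻¹`. -/
theorem one_le_pow_mul_norm_factorial {p : ℕ} (hp : p.Prime) (hp1 : ‖(p : K)‖ < 1) (hρ : 1 ≤ ρ)
    (hρp : ρ ^ (p - 1) = ‖(p : K)‖⁻¹) (n : ℕ) : 1 ≤ ρ ^ n * ‖((n + 1)! : K)‖ := by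
  have : Fact p.Prime := ⟨hp⟩
  have hp0 : 0 < ‖(p : K)‖ := by simpa using hp.ne_zero
  have hlt := sub_one_mul_padicValNat_factorial_lt_of_ne_zero p (n := n + 1) (by omega)
  obtain ⟨m, hm, hpm⟩ : ∃ m, (n + 1)! = p ^ padicValNat p (n + 1)! * m ∧ ¬ p ∣ m := by
    obtain ⟨m, hm⟩ := pow_padicValNat_dvd (p := p) (n := (n + 1)!)
    refine ⟨m, hm, fun ⟨l, hl⟩ => pow_succ_padicValNat_not_dvd (p := p)
      (Nat.factorial_ne_zero (n + 1)) ⟨l, ?_⟩⟩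
    rw [pow_succ, mul_assoc, ← hl, ← hm]
  -- the prime-to-`p` part of `(n + 1)!` is a unit, by a Bézout relation
  have hm1 : ‖(m : K)‖ = 1 := by
    refine le_antisymm (IsUltrametricDist.norm_natCast_le_one K m) ?_
    by_contra! hlt
    have hcop : Nat.Coprime p m := (Nat.Prime.coprime_iff_not_dvd hp).mpr hpm
    have hb : (p : ℤ) * p.gcdA m + m * p.gcdB m = 1 := by
      rw [← Nat.gcd_eq_gcd_ab, hcop.gcd_eq_one]; rfl
    have hbK : (p : K) * (p.gcdA m : ℤ) + (m : K) * (p.gcdB m : ℤ) = 1 := by exact_mod_cast hb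
    have h1 : ‖(p : K) * (p.gcdA m : ℤ)‖ < 1 := by
      rw [norm_mul]
      exact (mul_le_of_le_one_right (norm_nonneg _)
        (IsUltrametricDist.norm_intCast_le_one K _)).trans_lt hp1
    have h2 : ‖(m : K) * (p.gcdB m : ℤ)‖ < 1 := by
      rw [norm_mul]
      exact (mul_le_of_le_one_right (norm_nonneg _)
        (IsUltrametricDist.norm_intCast_le_one K _)).trans_lt hlt
    have := (IsUltrametricDist.norm_add_le_max ((p : K) * (p.gcdA m : ℤ))
      ((m : K) * (p.gcdB m : ℤ))).trans_lt (max_lt h1 h2)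
    rw [hbK, norm_one] at this
    exact lt_irrefl _ this
  have hfac : ‖((n + 1)! : K)‖ = ‖(p : K)‖ ^ padicValNat p (n + 1)! := by
    conv_lhs => rw [hm]
    push_cast
    rw [norm_mul, hm1, mul_one, norm_pow]
  rw [hfac, ← inv_inv ‖(p : K)‖, ← hρp, inv_pow, ← pow_mul, ← div_eq_mul_inv,
    one_le_div (by positivity)]
  exact pow_le_pow_right₀ hρ (by omega)

end Norm

end WeierstrassSeries

/-! ### Evaluation and translation of restricted power series -/

namespace PowerSeries

open Filter Topology
open scoped Nat

variable {K : Type*} [NormedField K]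

/-- The value at `z` of a power series. The junk value `0` is taken where it diverges. -/
noncomputable def evalSum (z : K) (f : K⟦X⟧) : K := ∑' n, coeff n f * z ^ n

/-- The expansion at `0` of `u ↦ f(u + v)`, as given by Taylor's formula. -/
noncomputable def taylorShift (v : K) (f : K⟦X⟧) : K⟦X⟧ :=
  mk fun n => evalSum v ((d⁄dX K)^[n] f) / (n ! : K)

theorem evalSum_C (z a : K) : evalSum z (C a) = a := by
  rw [evalSum, tsum_eq_single 0]
  · simp
  · intro n hn; simp [coeff_C, hn]

theorem evalSum_X (z : K) : evalSum z X = z := by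
  rw [evalSum, tsum_eq_single 1]
  · simp
  · intro n hn; simp [coeff_X, hn]

theorem taylorShift_C (v a : K) : taylorShift v (C a) = C a := by
  ext n
  rw [taylorShift, coeff_mk, coeff_C]
  rcases n with _ | n
  · simp [evalSum_C]
  · rw [Function.iterate_succ_apply, derivative_C, iterate_map_zero]
    simp [evalSum]

theorem constantCoeff_taylorShift (v : K) (f : K⟦X⟧) :
    constantCoeff (taylorShift v f) = evalSum v f := by
  rw [← coeff_zero_eq_constantCoeff_apply]; simp [taylorShift]

theorem derivative_taylorShift [CharZero K] (v : K) (f : K⟦X⟧) :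
    d⁄dX K (taylorShift v f) = taylorShift v (d⁄dX K f) := by
  ext n
  rw [coeff_derivative, taylorShift, taylorShift, coeff_mk, coeff_mk, Function.iterate_succ_apply,
    Nat.factorial_succ]
  have h1 : (n : K) + 1 ≠ 0 := by norm_cast
  have h2 : (n ! : K) ≠ 0 := by exact_mod_cast n.factorial_ne_zero
  push_cast
  field_simp

theorem taylorShift_X [CharZero K] (v : K) : taylorShift v X = X + C v := by
  refine derivative.ext ?_ ?_
  · rw [derivative_taylorShift, derivative_X, map_add, derivative_X, derivative_C, add_zero,
      ← map_one C, taylorShift_C]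
  · rw [constantCoeff_taylorShift, evalSum_X]; simp

theorem coeff_taylorShift [CharZero K] (v : K) (f : K⟦X⟧) (n : ℕ) : coeff n (taylorShift v f) =
    ∑' k, ((k + n).choose n : K) * coeff (k + n) f * v ^ k := by
  rw [taylorShift, coeff_mk, evalSum, ← tsum_div_const]
  refine tsum_congr fun k => ?_
  have h2 : (n ! : K) ≠ 0 := by exact_mod_cast n.factorial_ne_zero
  rw [coeff_iterate_derivative, Nat.ascFactorial_eq_factorial_mul_choose]
  push_cast
  field_simp

variable {c : ℝ} {u v z : K} {f g : K⟦X⟧}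

theorem isRestricted_X : IsRestricted c (X : K⟦X⟧) := isRestricted_monomial c 1 1

variable [IsUltrametricDist K]

theorem isRestricted_derivative (hc : 0 < c) (hf : IsRestricted c f) :
    IsRestricted c (d⁄dX K f) := by
  rw [isRestricted_iff'] at hf ⊢
  refine squeeze_zero (fun n => by positivity) (fun n => ?_)
    (by simpa using (hf.comp (tendsto_add_atTop_nat 1)).const_mul c⁻¹)
  have h1 : ‖(n : K) + 1‖ ≤ 1 := by
    exact_mod_cast IsUltrametricDist.norm_natCast_le_one K (n + 1)
  rw [coeff_derivative, norm_mul]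
  calc ‖coeff (n + 1) f‖ * ‖(n : K) + 1‖ * c ^ n ≤ ‖coeff (n + 1) f‖ * 1 * c ^ n := by gcongr
    _ = c⁻¹ * (‖coeff (n + 1) f‖ * c ^ (n + 1)) := by rw [pow_succ]; field_simp

theorem isRestricted_iterate_derivative (hc : 0 < c) (hf : IsRestricted c f) (n : ℕ) :
    IsRestricted c ((d⁄dX K)^[n] f) := by
  induction n with
  | zero => exact hf
  | succ n ih => rw [Function.iterate_succ_apply']; exact isRestricted_derivative hc ih

theorem norm_choose_mul_le (n k : ℕ) (x : K) : ‖((k + n).choose n : K) * x‖ ≤ ‖x‖ := by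
  rw [norm_mul]
  exact mul_le_of_le_one_left (norm_nonneg _) (IsUltrametricDist.norm_natCast_le_one K _)

/-- Binomial coefficients have norm at most `1`, so the coefficient of degree `n` of the translate
is bounded by those of degree at least `n` of `f`. -/
theorem isRestricted_taylorShift [CharZero K] (hf : IsRestricted c f) (hv : ‖v‖ ≤ c) :
    IsRestricted c (taylorShift v f) := by
  have hc : 0 ≤ c := (norm_nonneg v).trans hv
  rw [isRestricted_iff'] at hf ⊢
  rw [Metric.tendsto_atTop] at hf ⊢
  intro ε hε
  obtain ⟨N, hN⟩ := hf (ε / 2) (by positivity)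
  refine ⟨N, fun n hn => ?_⟩
  have : ‖coeff n (taylorShift v f)‖ * c ^ n ≤ ε / 2 := by
    rw [coeff_taylorShift]
    rcases (pow_nonneg hc n).eq_or_lt with h0 | h0
    · rw [← h0, mul_zero]; positivity
    rw [← le_div_iff₀ h0]
    refine IsUltrametricDist.norm_tsum_le_of_forall_le_of_nonneg (by positivity) fun k => ?_
    rw [le_div_iff₀ h0]
    have h := hN (k + n) (by omega)
    rw [dist_zero_right, Real.norm_of_nonneg (by positivity)] at h
    refine le_trans ?_ h.le
    rw [pow_add, ← mul_assoc, mul_assoc (Nat.cast _)]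
    refine mul_le_mul_of_nonneg_right ((norm_choose_mul_le (K := K) n k _).trans ?_) h0.le
    rw [norm_mul, norm_pow]
    gcongr
  rw [dist_zero_right, Real.norm_of_nonneg (by positivity)]
  linarith

variable [CompleteSpace K]

theorem summable_of_isRestricted (hf : IsRestricted c f) (hz : ‖z‖ ≤ c) :
    Summable fun n => coeff n f * z ^ n := by
  refine NonarchimedeanAddGroup.summable_of_tendsto_cofinite_zero ?_
  rw [Nat.cofinite_eq_atTop]
  refine squeeze_zero_norm (fun n => ?_) ((isRestricted_iff' c f).mp hf)
  rw [norm_mul, norm_pow]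
  gcongr

theorem evalSum_add (hf : IsRestricted c f) (hg : IsRestricted c g) (hz : ‖z‖ ≤ c) :
    evalSum z (f + g) = evalSum z f + evalSum z g := by
  rw [evalSum, evalSum, evalSum,
    ← (summable_of_isRestricted hf hz).tsum_add (summable_of_isRestricted hg hz)]
  simp only [map_add, add_mul]

theorem evalSum_mul (hf : IsRestricted c f) (hg : IsRestricted c g) (hz : ‖z‖ ≤ c) :
    evalSum z (f * g) = evalSum z f * evalSum z g := by
  have : NonarchimedeanRing K := ⟨NonarchimedeanAddGroup.is_nonarchimedean⟩
  have key : ∀ a b : ℕ → K, Summable a → Summable b →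
      (∑' n, a n) * (∑' n, b n) =
        ∑' n, ∑ ij ∈ Finset.HasAntidiagonal.antidiagonal n, a ij.1 * b ij.2 := fun a b ha hb =>
    ha.tsum_mul_tsum_eq_tsum_sum_antidiagonal hb (ha.mul_of_nonarchimedean hb)
  rw [evalSum, evalSum, evalSum,
    key _ _ (summable_of_isRestricted hf hz) (summable_of_isRestricted hg hz)]
  refine tsum_congr fun n => ?_
  rw [coeff_mul, Finset.sum_mul]
  refine Finset.sum_congr rfl fun ij hij => ?_
  rw [← Finset.HasAntidiagonal.mem_antidiagonal.mp hij, pow_add]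
  ring

theorem taylorShift_add (hc : 0 < c) (hf : IsRestricted c f) (hg : IsRestricted c g)
    (hv : ‖v‖ ≤ c) : taylorShift v (f + g) = taylorShift v f + taylorShift v g := by
  ext n
  rw [map_add, taylorShift, taylorShift, taylorShift, coeff_mk, coeff_mk, coeff_mk,
    iterate_map_add, evalSum_add (isRestricted_iterate_derivative hc hf n)
      (isRestricted_iterate_derivative hc hg n) hv,
    add_div]

/-- Evaluation at a point `z` of the closed disc of radius `c`, as a ring homomorphism. -/
noncomputable def evalHom (hz : ‖z‖ ≤ c) : IsRestricted.subring (R := K) c →+* K where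
  toFun f := evalSum z f
  map_one' := by rw [Subring.coe_one, ← map_one C, evalSum_C]
  map_mul' f g := evalSum_mul f.2 g.2 hz
  map_zero' := by rw [Subring.coe_zero, ← map_zero C, evalSum_C]
  map_add' f g := evalSum_add f.2 g.2 hz

theorem evalHom_apply (hz : ‖z‖ ≤ c) (f : IsRestricted.subring (R := K) c) :
    evalHom hz f = evalSum z f := rfl

variable [CharZero K]

/-- Both sides have the same constant term, and by the product rule their derivatives are sums of
two expressions of the same kind; hence an induction on the degree of the coefficient. -/
theorem taylorShift_mul (hc : 0 < c) (hf : IsRestricted c f) (hg : IsRestricted c g)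
    (hv : ‖v‖ ≤ c) : taylorShift v (f * g) = taylorShift v f * taylorShift v g := by
  ext n
  induction n generalizing f g with
  | zero =>
    simp only [coeff_zero_eq_constantCoeff, map_mul, constantCoeff_taylorShift,
      evalSum_mul hf hg hv]
  | succ n ih =>
    have h1 : (n : K) + 1 ≠ 0 := by norm_cast
    refine mul_right_cancel₀ h1 ?_
    rw [← coeff_derivative, ← coeff_derivative, derivative_taylorShift, Derivation.leibniz,
      Derivation.leibniz, derivative_taylorShift, derivative_taylorShift, smul_eq_mul, smul_eq_mul,
      smul_eq_mul, smul_eq_mul,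
      taylorShift_add hc (isRestricted.mul c hf (isRestricted_derivative hc hg))
      (isRestricted.mul c hg (isRestricted_derivative hc hf)) hv, map_add, map_add,
      ih hf (isRestricted_derivative hc hg), ih hg (isRestricted_derivative hc hf)]

theorem tsum_prod_eq_tsum_sum_antidiagonal {K : Type*} [NormedField K] [CompleteSpace K]
    {F : ℕ × ℕ → K} (hF : Summable F) :
    ∑' p, F p = ∑' n, ∑ p ∈ Finset.HasAntidiagonal.antidiagonal n, F p := by
  have hG : Summable fun p : Σ n : ℕ, Finset.HasAntidiagonal.antidiagonal n =>
      F (Finset.HasAntidiagonal.sigmaAntidiagonalEquivProd p) :=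
    Finset.HasAntidiagonal.sigmaAntidiagonalEquivProd.summable_iff.mpr hF
  rw [← Finset.HasAntidiagonal.sigmaAntidiagonalEquivProd.tsum_eq F, hG.tsum_sigma]
  refine tsum_congr fun n => ?_
  rw [tsum_fintype, ← Finset.sum_coe_sort (Finset.HasAntidiagonal.antidiagonal n)]
  rfl

/-- Taylor's formula `f(u + v) = ∑ f⁽ⁿ⁾(v) uⁿ / n!`. It holds on the whole closed disc, because the
double series converges unconditionally over a non-archimedean field. -/
theorem evalSum_taylorShift (hf : IsRestricted c f) (hu : ‖u‖ ≤ c) (hv : ‖v‖ ≤ c) :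
    evalSum u (taylorShift v f) = evalSum (u + v) f := by
  have hc : 0 ≤ c := (norm_nonneg v).trans hv
  let F : ℕ × ℕ → K := fun p => ((p.2 + p.1).choose p.1 : K) * coeff (p.2 + p.1) f * v ^ p.2 *
    u ^ p.1
  have hF : Summable F := by
    refine NonarchimedeanAddGroup.summable_of_tendsto_cofinite_zero ?_
    have hsum : Tendsto (fun p : ℕ × ℕ => p.2 + p.1) cofinite cofinite := by
      refine Tendsto.cofinite_of_finite_preimage_singleton fun m => ?_
      refine ((Set.finite_Iic m).prod (Set.finite_Iic m)).subset ?_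
      rintro ⟨i, j⟩ h
      simp only [Set.mem_preimage, Set.mem_singleton_iff] at h
      simp only [Set.mem_prod, Set.mem_Iic]
      omega
    refine squeeze_zero_norm (fun p => ?_) (((isRestricted_iff c f).mp hf).comp hsum)
    simp only [F, Function.comp_apply]
    rw [mul_assoc, mul_assoc]
    refine (norm_choose_mul_le _ _ _).trans ?_
    rw [norm_mul, norm_mul, norm_pow, norm_pow, pow_add]
    gcongr
  have h1 : evalSum u (taylorShift v f) = ∑' p, F p := by
    rw [hF.tsum_prod, evalSum]
    refine tsum_congr fun n => ?_
    rw [coeff_taylorShift, ← tsum_mul_right]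
  rw [h1, tsum_prod_eq_tsum_sum_antidiagonal hF, evalSum]
  refine tsum_congr fun n => ?_
  rw [(Commute.all u v).add_pow', Finset.mul_sum]
  refine Finset.sum_congr rfl fun p hp => ?_
  rw [Finset.HasAntidiagonal.mem_antidiagonal] at hp
  simp only [F]
  rw [add_comm, hp, nsmul_eq_mul]
  ring

/-- The expansion of `u ↦ f(u + v)` on a closed disc that contains `v`, as a ring homomorphism. -/
noncomputable def taylorHom (hc : 0 < c) (hv : ‖v‖ ≤ c) :
    IsRestricted.subring (R := K) c →+* IsRestricted.subring (R := K) c where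
  toFun f := ⟨taylorShift v f, isRestricted_taylorShift f.2 hv⟩
  map_one' := Subtype.ext (by simp only [Subring.coe_one]; rw [← map_one C, taylorShift_C])
  map_mul' f g := Subtype.ext (taylorShift_mul hc f.2 g.2 hv)
  map_zero' := Subtype.ext (by simp only [Subring.coe_zero]; rw [← map_zero C, taylorShift_C])
  map_add' f g := Subtype.ext (taylorShift_add hc f.2 g.2 hv)

theorem coe_taylorHom (hc : 0 < c) (hv : ‖v‖ ≤ c) (f : IsRestricted.subring (R := K) c) :
    (taylorHom hc hv f : K⟦X⟧) = taylorShift v f := rfl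

end PowerSeries

/-! ### The chord construction as a formal solution of the differential equation -/

namespace WeierstrassSeries

open PowerSeries

section Formal

variable {K : Type*} [Field K] {a₂ a₄ q r : K}

/-- The equation `℘'' = 6 ℘² - g₂ / 2`, written for the abscissa of the model, determines a formal
solution by its value and first derivative at `0`. -/
theorem eq_of_derivative_derivative_eq [CharZero K] {G H : K⟦X⟧}
    (hG : d⁄dX K (d⁄dX K G) = 6 * G ^ 2 + 4 * C a₂ * G + 2 * C a₄)
    (hH : d⁄dX K (d⁄dX K H) = 6 * H ^ 2 + 4 * C a₂ * H + 2 * C a₄)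
    (h0 : constantCoeff G = constantCoeff H)
    (h1 : constantCoeff (d⁄dX K G) = constantCoeff (d⁄dX K H)) : G = H := by
  have hE : d⁄dX K (d⁄dX K (G - H)) = (G - H) * (6 * (G + H) + 4 * C a₂) := by
    rw [map_sub, map_sub, hG, hH]; ring
  have h0' : coeff 0 (G - H) = 0 := by simp [h0]
  have h1' : coeff 1 (G - H) = 0 := by
    have := coeff_derivative (G - H) 0
    rw [coeff_zero_eq_constantCoeff_apply, map_sub, map_sub, h1, sub_self] at this
    simpa using this.symm
  rw [← sub_eq_zero]
  generalize 6 * (G + H) + 4 * C a₂ = M at hE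
  generalize G - H = E at *
  ext n
  rw [map_zero]
  induction n using Nat.strong_induction_on with
  | _ n ih =>
    rcases n with _ | _ | n
    · exact h0'
    · exact h1'
    · have h := congrArg (coeff n) hE
      rw [coeff_derivative, coeff_derivative, coeff_mul, Finset.sum_eq_zero] at h
      · have e1 : ((n + 1 : ℕ) : K) + 1 ≠ 0 := by norm_cast
        have e2 : (n : K) + 1 ≠ 0 := by norm_cast
        exact (mul_eq_zero.mp ((mul_eq_zero.mp h).resolve_right e2)).resolve_right e1
      · intro ij hij
        have := Finset.HasAntidiagonal.mem_antidiagonal.mp hij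
        rw [ih ij.1 (by omega), zero_mul]

variable (a₂ a₄) in
theorem exists_absSeries_eq :
    ∃ p : K⟦X⟧, absSeries a₂ a₄ = 1 - C (a₂ / 3) * X ^ 2 + X ^ 4 * p := by
  obtain ⟨R, hR⟩ := exists_wpSeries_eq (modelG₂ a₂ a₄) (modelG₃ a₂ a₄)
  refine ⟨C (modelG₂ a₂ a₄ / 20) + C (modelG₃ a₂ a₄ / 28) * X ^ 2 + X ^ 4 * R, ?_⟩
  rw [absSeries, hR]
  ring

variable (a₂ a₄) in
theorem exists_ordSeries_eq : ∃ s : K⟦X⟧, ordSeries a₂ a₄ = -2 + X ^ 4 * s := by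
  obtain ⟨R, hR⟩ := exists_wpDerivSeries_eq (modelG₂ a₂ a₄) (modelG₃ a₂ a₄)
  refine ⟨2 * C (modelG₂ a₂ a₄ / 20) + 4 * C (modelG₃ a₂ a₄ / 28) * X ^ 2 + X ^ 4 * R, ?_⟩
  rw [ordSeries, hR]
  ring

/-- The chord construction through the generic point `(X(u), Y(u))` and a fixed point `(q, r / 2)`
produces a solution `H` of `H'' = 6 H² + 4 a₂ H + 2 a₄`. Here `m / (2 u)` is the slope. -/
theorem exists_chord_solution [CharZero K]
    (hr : r ^ 2 = 4 * (q ^ 3 + a₂ * q ^ 2 + a₄ * q)) :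
    ∃ m H : K⟦X⟧, ordSeries a₂ a₄ - C r * X ^ 3 = m * (absSeries a₂ a₄ - C q * X ^ 2) ∧
      4 * (X ^ 2 * H) = m ^ 2 - 4 * (absSeries a₂ a₄ - C q * X ^ 2)
        - 4 * (2 * C q + C a₂) * X ^ 2 ∧
      4 * (X ^ 3 * d⁄dX K H) = -m * (4 * (X ^ 2 * H) - 4 * C q * X ^ 2) - 4 * C r * X ^ 3 ∧
      constantCoeff H = q ∧ constantCoeff (d⁄dX K H) = r ∧
      d⁄dX K (d⁄dX K H) = 6 * H ^ 2 + 4 * C a₂ * H + 2 * C a₄ := by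
  have hP := X_mul_derivative_absSeries a₂ a₄
  have hQ := X_mul_derivative_ordSeries a₂ a₄
  have hE := ordSeries_sq a₂ a₄
  have hP0 := constantCoeff_absSeries a₂ a₄
  obtain ⟨p, hp⟩ := exists_absSeries_eq a₂ a₄
  obtain ⟨s, hs⟩ := exists_ordSeries_eq a₂ a₄
  have h3 := C_eq_three_mul a₂
  have h4 : (4 : K⟦X⟧) * C (1 / 4) = 1 := by
    rw [← map_ofNat C 4, ← map_mul, ← map_one C]; congr 1; norm_num
  have hrC : C r ^ 2 = 4 * (C q ^ 3 + C a₂ * C q ^ 2 + C a₄ * C q) := by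
    rw [← map_pow, hr]
    simp only [map_mul, map_add, map_pow, map_ofNat]
  set P := absSeries a₂ a₄
  set Q := ordSeries a₂ a₄
  obtain ⟨U, hU⟩ : ∃ U, U = P - C q * X ^ 2 := ⟨_, rfl⟩
  obtain ⟨V, hV⟩ : ∃ V, V = Q - C r * X ^ 3 := ⟨_, rfl⟩
  have hU0 : constantCoeff U = 1 := by rw [hU]; simp [hP0]
  have hUne : U ≠ 0 := by rintro rfl; simp at hU0
  have hUi : U * U⁻¹ = 1 := PowerSeries.mul_inv_cancel _ (by rw [hU0]; exact one_ne_zero)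
  obtain ⟨m, hm⟩ : ∃ m, m = V * U⁻¹ := ⟨_, rfl⟩
  have hVm : V = m * U := by rw [hm]; linear_combination -V * hUi
  have hXU : X * d⁄dX K U = 2 * U + V + C r * X ^ 3 := by
    rw [hU, hV]
    simp only [map_sub, Derivation.leibniz, derivative_C, derivative_pow, derivative_X, smul_eq_mul]
    push_cast
    linear_combination hP
  have hXV : X * d⁄dX K V = 3 * V + (6 * P ^ 2 + 4 * C a₂ * X ^ 2 * P + 2 * C a₄ * X ^ 4) := by
    rw [hV]
    simp only [map_sub, Derivation.leibniz, derivative_C, derivative_pow, derivative_X, smul_eq_mul]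
    push_cast
    linear_combination hQ
  have hPU : P = U + C q * X ^ 2 := by rw [hU]; ring
  have hQV : Q = V + C r * X ^ 3 := by rw [hV]; ring
  -- the equation of the curve, divided by `U`
  have hstar : m ^ 2 * U + 2 * C r * X ^ 3 * m
      - 2 * (6 * C q ^ 2 + 4 * C a₂ * C q + 2 * C a₄) * X ^ 4 =
      4 * U ^ 2 + 4 * (3 * C q + C a₂) * X ^ 2 * U := by
    refine mul_left_cancel₀ hUne ?_
    rw [hQV, hVm, hPU] at hE
    linear_combination hE - X ^ 6 * hrC
  have hXm : 2 * (X * d⁄dX K m) = 2 * m - m ^ 2 + 8 * U + 4 * (3 * C q + C a₂) * X ^ 2 := by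
    refine mul_left_cancel₀ hUne ?_
    have h := hXV
    rw [hVm, Derivation.leibniz, smul_eq_mul, smul_eq_mul, hPU] at h
    linear_combination 2 * h - 2 * m * hXU - 2 * m * hVm - hstar
  -- Both `U` and `m` are units, and `m² / (4 X²)` has a double pole at `0` that `U / X²` cancels;
  -- expanding up to order four shows that what remains is `q + r X + O(X²)`.
  obtain ⟨T, hT⟩ : ∃ T, V ^ 2 - 4 * U ^ 2 * (U + (3 * C q + C a₂) * X ^ 2 + C r * X ^ 3) =
      X ^ 4 * T := by
    refine ⟨C r ^ 2 * X ^ 2 - 4 * s - 2 * C r * X ^ 3 * s + X ^ 4 * s ^ 2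
      - 4 * (p - 4 * (C (a₂ / 3) + C q) ^ 2 - 2 * (C (a₂ / 3) + C q) * C r * X
        - 2 * (C (a₂ / 3) + C q) * p * X ^ 2
        + ((C (a₂ / 3) + C q) ^ 2 + 2 * p - 2 * (C (a₂ / 3) + C q) * p * X ^ 2 + X ^ 4 * p ^ 2)
          * (1 + 2 * (C (a₂ / 3) + C q) * X ^ 2 + C r * X ^ 3 + X ^ 4 * p)), ?_⟩
    rw [hV, hU, hp, hs, h3]
    ring
  obtain ⟨H, hH⟩ : ∃ H, H = C q + C r * X + X ^ 2 * (C (1 / 4) * U⁻¹ ^ 2 * T) := ⟨_, rfl⟩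
  have hN : 4 * (X ^ 2 * H) = m ^ 2 - 4 * U - 4 * (2 * C q + C a₂) * X ^ 2 := by
    rw [hH, hm]
    linear_combination X ^ 4 * U⁻¹ ^ 2 * T * h4 - U⁻¹ ^ 2 * hT
      - 4 * (U + (3 * C q + C a₂) * X ^ 2 + C r * X ^ 3) * (U * U⁻¹ + 1) * hUi
  have hM : 4 * (X ^ 3 * d⁄dX K H) =
      -m * (4 * (X ^ 2 * H) - 4 * C q * X ^ 2) - 4 * C r * X ^ 3 := by
    have h := congrArg (fun f => X * d⁄dX K f) hN
    simp only [map_sub, Derivation.leibniz, derivative_C, derivative_pow, derivative_X, map_add,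
      smul_eq_mul, derivative_ofNat] at h
    push_cast at h
    linear_combination h + m * hXm - 4 * hXU - 2 * hN - 4 * hVm + m * hN
  refine ⟨m, H, ?_, ?_, hM, ?_, ?_, ?_⟩
  · rw [← hV, ← hU, hVm]
  · rw [← hU, hN]
  · rw [hH]; simp
  · rw [hH]; simp
  · have h := congrArg (fun f => X * d⁄dX K f) hM
    simp only [map_sub, map_neg, Derivation.leibniz, derivative_C, derivative_pow, derivative_X,
      smul_eq_mul, derivative_ofNat] at h
    push_cast at h
    have h16 : (16 : K⟦X⟧) ≠ 0 := fun h0 => by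
      simpa [constantCoeff_ofNat] using congrArg constantCoeff h0
    refine mul_left_cancel₀ (mul_ne_zero h16 (pow_ne_zero 4 (X_ne_zero (R := K)))) ?_
    linear_combination 4 * h - 2 * (4 * (X ^ 2 * H) - 4 * C q * X ^ 2) * hXm - (12 + 4 * m) * hM
      + (6 * m ^ 2 - 16 * U - 8 * (3 * C q + C a₂) * X ^ 2 - 16 * C a₂ * X ^ 2
        - 6 * (4 * (X ^ 2 * H) + (m ^ 2 - 4 * U - 4 * (2 * C q + C a₂) * X ^ 2))) * hN + 8 * hstar

end Formal

end WeierstrassSeries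

/-! ### The addition theorem -/

namespace WeierstrassSeries

open PowerSeries

section Values

variable {K : Type*} [NormedField K]

/-- The value `X(z) = ℘(z) - a₂ / 3`, for `z ≠ 0` where the series converge. -/
noncomputable def absVal (a₂ a₄ z : K) : K := evalSum z (absSeries a₂ a₄) / z ^ 2

/-- The value `Y(z) = ℘'(z) / 2`, for `z ≠ 0` where the series converge. -/
noncomputable def ordVal (a₂ a₄ z : K) : K := evalSum z (ordSeries a₂ a₄) / (2 * z ^ 3)

theorem evalSum_neg_expand (f : K⟦X⟧) (z : K) :
    evalSum (-z) (expand 2 two_ne_zero f) = evalSum z (expand 2 two_ne_zero f) := by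
  refine tsum_congr fun n => ?_
  rw [coeff_expand]
  split_ifs with h
  · rw [Even.neg_pow (even_iff_two_dvd.mpr h)]
  · simp

variable (a₂ a₄ z : K)

theorem absVal_neg : absVal a₂ a₄ (-z) = absVal a₂ a₄ z := by
  have : absSeries a₂ a₄ = expand 2 two_ne_zero
      (evenSeries (modelG₂ a₂ a₄) (modelG₃ a₂ a₄) - C (a₂ / 3) * X) := by
    rw [map_sub, map_mul, expand_X, expand_C, absSeries, wpSeries]
  rw [absVal, absVal, this, evalSum_neg_expand, neg_sq]

theorem ordVal_neg : ordVal a₂ a₄ (-z) = -ordVal a₂ a₄ z := by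
  have : ordSeries a₂ a₄ = expand 2 two_ne_zero
      (2 * (X * d⁄dX K (evenSeries (modelG₂ a₂ a₄) (modelG₃ a₂ a₄)))
        - 2 * evenSeries (modelG₂ a₂ a₄) (modelG₃ a₂ a₄)) := by
    rw [map_sub, map_mul _ 2, map_mul _ 2, map_ofNat, ← X_mul_derivative_expand, ordSeries,
      wpDerivSeries, wpSeries]
  rw [ordVal, ordVal, this, evalSum_neg_expand, Odd.neg_pow (by decide), mul_neg, div_neg]

variable {a₂ a₄ z} [IsUltrametricDist K] {c : ℝ} {u v : K}

theorem isRestricted_ordSeries (hc : 0 < c) (h : IsRestricted c (absSeries a₂ a₄)) :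
    IsRestricted c (ordSeries a₂ a₄) := by
  have e : ordSeries a₂ a₄ = X * d⁄dX K (absSeries a₂ a₄) - C 2 * absSeries a₂ a₄ := by
    rw [X_mul_derivative_absSeries, map_ofNat]; ring
  rw [e]
  exact (IsRestricted.subring (R := K) c).sub_mem
    (isRestricted.mul c isRestricted_X (isRestricted_derivative hc h))
    (isRestricted.mul c (isRestricted_C c _) h)

variable [CompleteSpace K] [CharZero K]

theorem evalSum_ordSeries_sq (hc : 0 < c) (h : IsRestricted c (absSeries a₂ a₄)) (hz : ‖z‖ ≤ c) :
    evalSum z (ordSeries a₂ a₄) ^ 2 = 4 * (evalSum z (absSeries a₂ a₄) ^ 3 +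
      a₂ * z ^ 2 * evalSum z (absSeries a₂ a₄) ^ 2 +
      a₄ * z ^ 4 * evalSum z (absSeries a₂ a₄)) := by
  let p : IsRestricted.subring (R := K) c := ⟨_, h⟩
  let q : IsRestricted.subring (R := K) c := ⟨_, isRestricted_ordSeries hc h⟩
  let t : IsRestricted.subring (R := K) c := ⟨X, isRestricted_X⟩
  let k : K → IsRestricted.subring (R := K) c := fun a => ⟨C a, isRestricted_C c a⟩
  have key : q ^ 2 = 4 * (p ^ 3 + k a₂ * t ^ 2 * p ^ 2 + k a₄ * t ^ 4 * p) :=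
    Subtype.ext (ordSeries_sq a₂ a₄)
  have := congrArg (evalHom hz) key
  simp only [map_mul, map_add, map_pow, map_ofNat, evalHom_apply] at this
  simpa only [p, q, t, k, evalSum_C, evalSum_X] using this

theorem ordVal_sq (hc : 0 < c) (h : IsRestricted c (absSeries a₂ a₄)) (hz : ‖z‖ ≤ c)
    (hz0 : z ≠ 0) : ordVal a₂ a₄ z ^ 2 =
      absVal a₂ a₄ z ^ 3 + a₂ * absVal a₂ a₄ z ^ 2 + a₄ * absVal a₂ a₄ z := by
  have := evalSum_ordSeries_sq hc h hz
  rw [ordVal, absVal]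
  field_simp
  linear_combination this

/-- The addition theorem as an identity of power series in `u`, for a fixed `v ≠ 0`. Both the
translate `X(u + v)` and the abscissa given by the chord construction solve
`H'' = 6 H² + 4 a₂ H + 2 a₄`, with the same initial values at `u = 0`. -/
theorem taylorShift_chord (hc : 0 < c) (h : IsRestricted c (absSeries a₂ a₄)) (hv : ‖v‖ ≤ c)
    (hv0 : v ≠ 0) {q r : K} (hq : q = absVal a₂ a₄ v) (hr : r = 2 * ordVal a₂ a₄ v) {U V l : K⟦X⟧}
    (hU : U = absSeries a₂ a₄ - C q * X ^ 2) (hV : V = ordSeries a₂ a₄ - C r * X ^ 3)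
    (hl : l = X + C v) :
    4 * U ^ 2 * taylorShift v (absSeries a₂ a₄) * X ^ 2 =
        l ^ 2 * (V ^ 2 - 4 * U ^ 2 * (U + (2 * C q + C a₂) * X ^ 2)) ∧
      X * U * taylorShift v (ordSeries a₂ a₄) =
        -V * (taylorShift v (absSeries a₂ a₄) - C q * l ^ 2) * l - C r * X * l ^ 3 * U := by
  have hr2 : r ^ 2 = 4 * (q ^ 3 + a₂ * q ^ 2 + a₄ * q) := by
    rw [hq, hr, mul_pow, ordVal_sq hc h hv hv0]; ring
  obtain ⟨m, H, hm, hN, hM, hH0, hH1, hH2⟩ := exists_chord_solution hr2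
  -- the two differential equations are identities between restricted series, to which the
  -- translation homomorphism applies
  let p : IsRestricted.subring (R := K) c := ⟨_, h⟩
  let p' : IsRestricted.subring (R := K) c := ⟨_, isRestricted_derivative hc h⟩
  let s : IsRestricted.subring (R := K) c := ⟨_, isRestricted_ordSeries hc h⟩
  let s' : IsRestricted.subring (R := K) c :=
    ⟨_, isRestricted_derivative hc (isRestricted_ordSeries hc h)⟩
  let t : IsRestricted.subring (R := K) c := ⟨X, isRestricted_X⟩
  let k : K → IsRestricted.subring (R := K) c := fun a => ⟨C a, isRestricted_C c a⟩
  have key1 : t * p' = 2 * p + s := Subtype.ext (X_mul_derivative_absSeries a₂ a₄)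
  have key2 : t * s' = 3 * s + 6 * p ^ 2 + 4 * k a₂ * t ^ 2 * p + 2 * k a₄ * t ^ 4 :=
    Subtype.ext (X_mul_derivative_ordSeries a₂ a₄)
  have hP := congrArg (fun f => (IsRestricted.subring (R := K) c).subtype (taylorHom hc hv f)) key1
  have hQ := congrArg (fun f => (IsRestricted.subring (R := K) c).subtype (taylorHom hc hv f)) key2
  simp only [map_mul, map_add, map_pow, map_ofNat, Subring.subtype_apply, coe_taylorHom] at hP hQ
  simp only [p, p', s, s', t, k, taylorShift_C, taylorShift_X, ← derivative_taylorShift,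
    ← hl] at hP hQ
  have hp0 := constantCoeff_taylorShift v (absSeries a₂ a₄)
  have hs0 := constantCoeff_taylorShift v (ordSeries a₂ a₄)
  set P := taylorShift v (absSeries a₂ a₄)
  set Q := taylorShift v (ordSeries a₂ a₄)
  have hl0 : constantCoeff l = v := by rw [hl]; simp
  have hli : l * l⁻¹ = 1 := PowerSeries.mul_inv_cancel _ (by rwa [hl0])
  have hdl : d⁄dX K l = 1 := by rw [hl]; simp
  have hdP : d⁄dX K P = l⁻¹ * (2 * P + Q) := by linear_combination l⁻¹ * hP - d⁄dX K P * hli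
  have hdQ : d⁄dX K Q = l⁻¹ * (3 * Q + 6 * P ^ 2 + 4 * C a₂ * l ^ 2 * P + 2 * C a₄ * l ^ 4) := by
    linear_combination l⁻¹ * hQ - d⁄dX K Q * hli
  obtain ⟨G, hG⟩ : ∃ G, G = P * l⁻¹ ^ 2 := ⟨_, rfl⟩
  have hG1 : d⁄dX K G = l⁻¹ ^ 3 * Q := by
    rw [hG]
    simp only [Derivation.leibniz, derivative_pow, derivative_inv', hdP, hdl, smul_eq_mul]
    push_cast
    ring
  have hG2 : d⁄dX K (d⁄dX K G) = 6 * G ^ 2 + 4 * C a₂ * G + 2 * C a₄ := by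
    rw [hG1]
    simp only [Derivation.leibniz, derivative_pow, derivative_inv', hdQ, hdl, smul_eq_mul]
    push_cast
    rw [hG]
    linear_combination (4 * C a₂ * P * l⁻¹ ^ 2 * (l * l⁻¹ + 1)
      + 2 * C a₄ * (l ^ 2 * l⁻¹ ^ 2 + 1) * (l * l⁻¹ + 1)) * hli
  have hGH : G = H := by
    refine eq_of_derivative_derivative_eq hG2 hH2 ?_ ?_
    · rw [hH0, hG, hq, absVal, map_mul, map_pow, constantCoeff_inv, hl0, hp0]; field_simp
    · rw [hH1, hG1, hr, ordVal, map_mul, map_pow, constantCoeff_inv, hl0, hs0]; field_simp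
  rw [← hV, ← hU] at hm
  rw [← hU, ← hGH, hG] at hN
  rw [← hGH, hG1, hG] at hM
  constructor
  · rw [hm]
    linear_combination U ^ 2 * l ^ 2 * hN - 4 * U ^ 2 * X ^ 2 * P * (l * l⁻¹ + 1) * hli
  · have h4 : (4 : K⟦X⟧) ≠ 0 := fun h0 => by
      simpa [constantCoeff_ofNat] using congrArg constantCoeff h0
    refine mul_left_cancel₀ (mul_ne_zero h4 (pow_ne_zero 2 (X_ne_zero (R := K)))) ?_
    rw [hm]
    linear_combination U * l ^ 3 * hM - (4 * X ^ 3 * Q * U * (l ^ 2 * l⁻¹ ^ 2 + l * l⁻¹ + 1) +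
      4 * m * U * X ^ 2 * P * l * (l * l⁻¹ + 1)) * hli

/-- The addition theorem for `X` and `Y`, with cleared denominators. -/
theorem absVal_add (hc : 0 < c) (h : IsRestricted c (absSeries a₂ a₄)) (hu : ‖u‖ ≤ c) (hv : ‖v‖ ≤ c)
    (hu0 : u ≠ 0) (hv0 : v ≠ 0) (huv : u + v ≠ 0) :
    (absVal a₂ a₄ u - absVal a₂ a₄ v) ^ 2 *
        (absVal a₂ a₄ (u + v) + a₂ + absVal a₂ a₄ u + absVal a₂ a₄ v) =
      (ordVal a₂ a₄ u - ordVal a₂ a₄ v) ^ 2 ∧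
    (absVal a₂ a₄ u - absVal a₂ a₄ v) * (ordVal a₂ a₄ (u + v) + ordVal a₂ a₄ v) =
      -(ordVal a₂ a₄ u - ordVal a₂ a₄ v) * (absVal a₂ a₄ (u + v) - absVal a₂ a₄ v) := by
  obtain ⟨h1, h2⟩ := taylorShift_chord hc h hv hv0 rfl rfl rfl rfl rfl
  have hs := isRestricted_ordSeries hc h
  let p : IsRestricted.subring (R := K) c := ⟨_, h⟩
  let s : IsRestricted.subring (R := K) c := ⟨_, hs⟩
  let t : IsRestricted.subring (R := K) c := ⟨X, isRestricted_X⟩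
  let k : K → IsRestricted.subring (R := K) c := fun a => ⟨C a, isRestricted_C c a⟩
  let q := absVal a₂ a₄ v
  let r := 2 * ordVal a₂ a₄ v
  have key1 : 4 * (p - k q * t ^ 2) ^ 2 * taylorHom hc hv p * t ^ 2 =
      (t + k v) ^ 2 * ((s - k r * t ^ 3) ^ 2 - 4 * (p - k q * t ^ 2) ^ 2 *
        ((p - k q * t ^ 2) + (2 * k q + k a₂) * t ^ 2)) := Subtype.ext h1
  have key2 : t * (p - k q * t ^ 2) * taylorHom hc hv s = -(s - k r * t ^ 3) *
      (taylorHom hc hv p - k q * (t + k v) ^ 2) * (t + k v) -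
        k r * t * (t + k v) ^ 3 * (p - k q * t ^ 2) := Subtype.ext h2
  have e1 := congrArg (evalHom hu) key1
  have e2 := congrArg (evalHom hu) key2
  simp only [map_mul, map_add, map_sub, map_neg, map_pow, map_ofNat, evalHom_apply,
    coe_taylorHom] at e1 e2
  simp only [p, s, t, k, evalSum_C, evalSum_X, evalSum_taylorShift h hu hv,
    evalSum_taylorShift hs hu hv] at e1 e2
  have hX : ∀ z : K, z ≠ 0 → evalSum z (absSeries a₂ a₄) = absVal a₂ a₄ z * z ^ 2 := fun z hz => by
    rw [absVal]; field_simp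
  have hY : ∀ z : K, z ≠ 0 → evalSum z (ordSeries a₂ a₄) = 2 * ordVal a₂ a₄ z * z ^ 3 :=
    fun z hz => by rw [ordVal]; field_simp
  rw [hX u hu0, hX _ huv, hY u hu0] at e1
  rw [hX u hu0, hX _ huv, hY u hu0, hY _ huv] at e2
  constructor
  · have h0 : 4 * u ^ 6 * (u + v) ^ 2 ≠ 0 := by simp [hu0, huv]
    refine mul_left_cancel₀ h0 ?_
    simp only [q, r] at e1
    linear_combination e1
  · have h0 : 2 * u ^ 3 * (u + v) ^ 3 ≠ 0 := by simp [hu0, huv]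
    refine mul_left_cancel₀ h0 ?_
    simp only [q, r] at e2
    linear_combination e2

/-- The point `(X(v), Y(v))` is never `(0, 0)`: that point has order two, but `X(2 v)` is finite. In
terms of power series in `u`, if `X(v) = 0` then `X(u) X(u + v) = a₄`, and one puts `u = v`. -/
theorem absVal_ne_zero (hc : 0 < c) (h : IsRestricted c (absSeries a₂ a₄)) (hv : ‖v‖ ≤ c)
    (hv0 : v ≠ 0) (ha : a₄ ≠ 0) : absVal a₂ a₄ v ≠ 0 := by
  intro hX
  have hY : 2 * ordVal a₂ a₄ v = 0 := by
    have := ordVal_sq hc h hv hv0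
    rw [hX] at this
    simpa using this
  obtain ⟨h1, -⟩ := taylorShift_chord hc h hv hv0 rfl rfl rfl rfl rfl
  rw [hX, hY] at h1
  simp only [map_zero, zero_mul, sub_zero, mul_zero, zero_add] at h1
  have hP : absSeries a₂ a₄ ≠ 0 := fun h0 => by
    have := constantCoeff_absSeries a₂ a₄
    rw [h0] at this
    simp at this
  have h4 : (4 : K⟦X⟧) ≠ 0 := fun h0 => by
    simpa [constantCoeff_ofNat] using congrArg constantCoeff h0
  have h5 : absSeries a₂ a₄ * taylorShift v (absSeries a₂ a₄) = (X + C v) ^ 2 * (C a₄ * X ^ 2) := by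
    refine mul_left_cancel₀
      (mul_ne_zero (mul_ne_zero h4 hP) (pow_ne_zero 2 (X_ne_zero (R := K)))) ?_
    linear_combination h1 + (X + C v) ^ 2 * ordSeries_sq a₂ a₄
  let p : IsRestricted.subring (R := K) c := ⟨_, h⟩
  let t : IsRestricted.subring (R := K) c := ⟨X, isRestricted_X⟩
  let k : K → IsRestricted.subring (R := K) c := fun a => ⟨C a, isRestricted_C c a⟩
  have key : p * taylorHom hc hv p = (t + k v) ^ 2 * (k a₄ * t ^ 2) := Subtype.ext h5
  have e := congrArg (evalHom hv) key
  simp only [map_mul, map_add, map_pow, evalHom_apply] at e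
  simp only [p, t, k, evalSum_C, evalSum_X] at e
  have h0 : evalSum v (absSeries a₂ a₄) = 0 := by
    rw [absVal, div_eq_zero_iff] at hX
    exact hX.resolve_right (pow_ne_zero 2 hv0)
  rw [h0, zero_mul, ← two_mul] at e
  simp [hv0, ha] at e

end Values

end WeierstrassSeries

/-! ### From the Weierstrass model to the Edwards curve -/

namespace EdwardsPoint

section Birational

variable {K : Type*} [Field K] {d x₁ y₁ : K}

/-- The equation `Y² = X³ + a' X² + b' X` in the form
`(1 - d) Y² = X ((X + x₁)² - d (X - x₁)²)`. -/
theorem one_sub_mul_sq (hd : 1 - d ≠ 0) {X Y : K}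
    (h : Y ^ 2 = X ^ 3 + Edwards.a' d x₁ * X ^ 2 + Edwards.b' d x₁ * X) :
    (1 - d) * Y ^ 2 = X * ((X + x₁) ^ 2 - d * (X - x₁) ^ 2) := by
  rw [h, Edwards.a', Edwards.b']
  field_simp
  ring

/-- The image in the Edwards curve of a point of `y² = x³ + a' x² + b' x` under `β`. -/
def ofModel (hx₁ : x₁ ≠ 0) (hd : 1 - d ≠ 0) (hy₁ : y₁ ^ 2 = 4 * x₁ ^ 3 / (1 - d)) {X Y : K}
    (h : Y ^ 2 = X ^ 3 + Edwards.a' d x₁ * X ^ 2 + Edwards.b' d x₁ * X) (hY : Y ≠ 0)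
    (hX : X + x₁ ≠ 0) : EdwardsPoint d where
  x := y₁ * X / (x₁ * Y)
  y := (X - x₁) / (X + x₁)
  on_curve := by
    have h1 := one_sub_mul_sq hd h
    have h2 : y₁ ^ 2 * (1 - d) = 4 * x₁ ^ 3 := by rw [hy₁]; field_simp
    field_simp
    refine mul_left_cancel₀ hd ?_
    linear_combination X ^ 2 * ((X + x₁) ^ 2 - d * (X - x₁) ^ 2) * h2 - 4 * x₁ ^ 3 * X * h1

/-- At `X = -x₁` the equation of the model reads `Y² = d y₁²`. -/
theorem add_x₁_ne_zero [Fact (¬ IsSquare d)] (hx₁ : x₁ ≠ 0) (hd : 1 - d ≠ 0) (h2 : (2 : K) ≠ 0)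
    (hy₁ : y₁ ^ 2 = 4 * x₁ ^ 3 / (1 - d)) {X Y : K}
    (h : Y ^ 2 = X ^ 3 + Edwards.a' d x₁ * X ^ 2 + Edwards.b' d x₁ * X) : X + x₁ ≠ 0 := by
  intro hX
  have hy0 : y₁ ≠ 0 := by
    rintro rfl
    have : 4 * x₁ ^ 3 / (1 - d) ≠ 0 :=
      div_ne_zero (mul_ne_zero (by rw [show (4 : K) = 2 * 2 by norm_num]; exact mul_ne_zero h2 h2)
        (pow_ne_zero 3 hx₁)) hd
    exact this (by rw [← hy₁]; ring)
  have h1 := one_sub_mul_sq hd h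
  have h3 : y₁ ^ 2 * (1 - d) = 4 * x₁ ^ 3 := by rw [hy₁]; field_simp
  obtain rfl : X = -x₁ := by linear_combination hX
  refine (Fact.out : ¬ IsSquare d) ⟨Y / y₁, ?_⟩
  field_simp
  refine mul_left_cancel₀ hd ?_
  linear_combination d * h3 - h1

/-- The points of order two other than `(0, 0)` would satisfy `(X + x₁)² = d (X - x₁)²`. -/
theorem eq_zero_of_ordinate_eq_zero [Fact (¬ IsSquare d)] (hx₁ : x₁ ≠ 0) (hd : 1 - d ≠ 0)
    (h2 : (2 : K) ≠ 0) {X : K}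
    (h : 0 = X ^ 3 + Edwards.a' d x₁ * X ^ 2 + Edwards.b' d x₁ * X) : X = 0 := by
  have h1 := one_sub_mul_sq hd (Y := 0) (by rw [← h]; ring)
  by_contra hX
  have h3 : (X + x₁) ^ 2 - d * (X - x₁) ^ 2 = 0 := by
    refine mul_left_cancel₀ hX ?_
    linear_combination -h1
  have h4 : X - x₁ ≠ 0 := by
    intro h4
    obtain rfl : X = x₁ := by linear_combination h4
    have : (2 * X) ^ 2 = 0 := by linear_combination h3
    exact mul_ne_zero h2 hX (pow_eq_zero_iff two_ne_zero |>.mp this)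
  refine (Fact.out : ¬ IsSquare d) ⟨(X + x₁) / (X - x₁), ?_⟩
  field_simp
  linear_combination -h3

section Chord

variable {X Y Z W S T α e : K}

theorem chord_sub_sq_mul (h : Y ^ 2 = X ^ 3 + α * X ^ 2 + e ^ 2 * X)
    (h' : W ^ 2 = Z ^ 3 + α * Z ^ 2 + e ^ 2 * Z)
    (hadd : (X - Z) ^ 2 * (S + α + X + Z) = (Y - W) ^ 2) :
    (X - Z) ^ 2 * S = X * Z * (X + Z) + 2 * α * (X * Z) + e ^ 2 * (X + Z) - 2 * Y * W := by
  linear_combination hadd + h + h'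

/-- The abscissa of the chord sum `(S, T)` of `(X, Y)` and `(Z, W)` on `y² = x³ + α x² + e² x`, in a
form without the difference `X - Z`, which the Edwards law does not contain either. -/
theorem chord_abscissa (h : Y ^ 2 = X ^ 3 + α * X ^ 2 + e ^ 2 * X)
    (h' : W ^ 2 = Z ^ 3 + α * Z ^ 2 + e ^ 2 * Z) (hXZ : X - Z ≠ 0)
    (hadd : (X - Z) ^ 2 * (S + α + X + Z) = (Y - W) ^ 2) :
    S * (Y * W * (X + Z) + X * Z * (2 * (X * Z + e ^ 2) + α * (X + Z))) =
      Y * W * (X * Z + e ^ 2) - X * Z * (α * (X * Z + e ^ 2) + 2 * e ^ 2 * (X + Z)) := by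
  refine mul_left_cancel₀ (pow_ne_zero 2 hXZ) ?_
  have hYW : Y ^ 2 * W ^ 2 = (X ^ 3 + α * X ^ 2 + e ^ 2 * X) *
      (Z ^ 3 + α * Z ^ 2 + e ^ 2 * Z) := by rw [h, h']
  linear_combination (Y * W * (X + Z) + X * Z * (2 * (X * Z + e ^ 2) + α * (X + Z))) *
    chord_sub_sq_mul h h' hadd - 2 * (X + Z) * hYW

/-- The ratio of the coordinates of the chord sum, likewise without the difference `X - Z`. -/
theorem chord_ordinate (h : Y ^ 2 = X ^ 3 + α * X ^ 2 + e ^ 2 * X)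
    (h' : W ^ 2 = Z ^ 3 + α * Z ^ 2 + e ^ 2 * Z) (hXZ : X - Z ≠ 0)
    (hadd : (X - Z) ^ 2 * (S + α + X + Z) = (Y - W) ^ 2)
    (hadd' : (X - Z) * (T + W) = -(Y - W) * (S - Z)) :
    S * (Y * W * (X + e) * (Z + e) + X * Z * (α - 2 * e) * (X - e) * (Z - e)) =
      T * (X * W * (Z - e) * (X + e) + Z * Y * (X - e) * (Z + e)) := by
  have hS := chord_sub_sq_mul h h' hadd
  have hT : (X - Z) ^ 3 * T = -W * (X - Z) ^ 3 - (Y - W) * ((X * Z * (X + Z) +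
      2 * α * (X * Z) + e ^ 2 * (X + Z) - 2 * Y * W) - Z * (X - Z) ^ 2) := by
    linear_combination (X - Z) ^ 2 * hadd' - (Y - W) * hS
  have key : (X - Z) * (X * Z * (X + Z) + 2 * α * (X * Z) + e ^ 2 * (X + Z) - 2 * Y * W) *
        (Y * W * (X + e) * (Z + e) + X * Z * (α - 2 * e) * (X - e) * (Z - e)) =
      (-W * (X - Z) ^ 3 - (Y - W) * ((X * Z * (X + Z) + 2 * α * (X * Z) + e ^ 2 * (X + Z)
        - 2 * Y * W) - Z * (X - Z) ^ 2)) *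
        (X * W * (Z - e) * (X + e) + Z * Y * (X - e) * (Z + e)) := by
    clear hadd hadd' hS hT hXZ
    grind
  refine mul_left_cancel₀ (pow_ne_zero 3 hXZ) ?_
  rw [← mul_assoc, ← mul_assoc, hT, ← key, ← hS]
  ring

end Chord

/-- The chord law on `y² = x³ + a' x² + b' x` is carried by `β` to the Edwards addition law. -/
theorem ofModel_add [NeZero (2 : K)] [Fact (¬ IsSquare d)] (hx₁ : x₁ ≠ 0) (hd : 1 - d ≠ 0)
    (hy₁ : y₁ ^ 2 = 4 * x₁ ^ 3 / (1 - d)) {X Y Z W S T : K}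
    (h : Y ^ 2 = X ^ 3 + Edwards.a' d x₁ * X ^ 2 + Edwards.b' d x₁ * X) (hY : Y ≠ 0)
    (hX : X + x₁ ≠ 0)
    (h' : W ^ 2 = Z ^ 3 + Edwards.a' d x₁ * Z ^ 2 + Edwards.b' d x₁ * Z) (hW : W ≠ 0)
    (hZ : Z + x₁ ≠ 0)
    (h'' : T ^ 2 = S ^ 3 + Edwards.a' d x₁ * S ^ 2 + Edwards.b' d x₁ * S) (hT : T ≠ 0)
    (hS : S + x₁ ≠ 0) (hXZ : X ≠ Z)
    (hadd : (X - Z) ^ 2 * (S + Edwards.a' d x₁ + X + Z) = (Y - W) ^ 2)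
    (hadd' : (X - Z) * (T + W) = -(Y - W) * (S - Z)) :
    ofModel hx₁ hd hy₁ h'' hT hS = ofModel hx₁ hd hy₁ h hY hX + ofModel hx₁ hd hy₁ h' hW hZ := by
  have hp := one_add_ne_zero (ofModel hx₁ hd hy₁ h hY hX) (ofModel hx₁ hd hy₁ h' hW hZ)
  have hm := one_sub_ne_zero (ofModel hx₁ hd hy₁ h hY hX) (ofModel hx₁ hd hy₁ h' hW hZ)
  have h2 : y₁ ^ 2 * (1 - d) = 4 * x₁ ^ 3 := by rw [hy₁]; field_simp
  have hy0 : y₁ ≠ 0 := by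
    rintro rfl
    exact hx₁ (by simpa [show (4 : K) = 2 * 2 by norm_num, NeZero.ne (2 : K)] using h2)
  have hXZ' : X - Z ≠ 0 := sub_ne_zero.mpr hXZ
  have ha : (1 - d) * Edwards.a' d x₁ = 2 * x₁ * (1 + d) := by rw [Edwards.a']; field_simp
  have key₁ := chord_abscissa h h' hXZ' hadd
  have key₂ := chord_ordinate h h' hXZ' hadd hadd'
  ext
  · rw [add_x, eq_div_iff hp]
    simp only [ofModel]
    field_simp
    refine mul_left_cancel₀ hd ?_
    linear_combination (1 - d) * x₁ ^ 2 * key₂ +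
      S * X * Z * (X - x₁) * (Z - x₁) * (d * h2 - x₁ ^ 2 * ha)
  · rw [add_y, eq_div_iff hm]
    simp only [ofModel]
    field_simp
    refine mul_left_cancel₀ hd ?_
    linear_combination 2 * x₁ ^ 3 * (1 - d) * key₁ +
      X * Z * ((S + x₁) * (X + x₁) * (Z + x₁) - d * (S - x₁) * (X - x₁) * (Z - x₁)) * h2 -
      2 * x₁ ^ 3 * X * Z * (S * (X + Z) + (X * Z + x₁ ^ 2)) * ha

end Birational

end EdwardsPoint

/-! ### The exponential map on a closed disc -/

namespace WeierstrassSeries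

open PowerSeries Filter Topology

section Link

variable {K : Type*} [NormedField K] {g₂ g₃ : K}

theorem wpSeries_eq (g₂ g₃ : K) :
    wpSeries g₂ g₃ = 1 + X ^ 4 * expand 2 two_ne_zero (tail g₂ g₃) := by
  rw [wpSeries, evenSeries, map_add, map_mul, map_pow, expand_X, map_one]
  ring

theorem wpDerivSeries_eq (g₂ g₃ : K) : wpDerivSeries g₂ g₃ = C (-2) + X ^ 4 *
    expand 2 two_ne_zero (mk fun k => (2 * (k : K) + 2) * wpCoeff g₂ g₃ (k + 2)) := by
  have e : (mk fun k => (2 * (k : K) + 2) * wpCoeff g₂ g₃ (k + 2)) =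
      2 * tail g₂ g₃ + 2 * (X * d⁄dX K (tail g₂ g₃)) := by
    ext k
    rw [map_add, coeff_ofNat_mul, coeff_ofNat_mul, coeff_X_mul_derivative, tail, coeff_mk, coeff_mk]
    ring
  have h := X_mul_derivative_expand (tail g₂ g₃)
  rw [e, map_add, map_mul, map_mul _ 2 (X * _), map_ofNat, ← h, wpDerivSeries, wpSeries_eq]
  simp only [map_add, Derivation.leibniz, derivative_pow, derivative_X, derivative_one, map_neg,
    map_ofNat, smul_eq_mul]
  push_cast
  ring

theorem evalSum_X_pow (z : K) (n : ℕ) : evalSum z (X ^ n) = z ^ n := by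
  rw [evalSum, tsum_eq_single n]
  · simp
  · intro m hm; simp [coeff_X_pow, hm]

theorem evalSum_expand (f : K⟦X⟧) (z : K) :
    evalSum z (expand 2 two_ne_zero f) = ∑' k, coeff k f * z ^ (2 * k) := by
  have hinj : Function.Injective fun k : ℕ => 2 * k := fun a b h => by dsimp at h; omega
  have hsup : Function.support (fun n => coeff n (expand 2 two_ne_zero f) * z ^ n) ⊆
      Set.range fun k : ℕ => 2 * k := by
    intro n hn
    rw [Function.mem_support, coeff_expand] at hn
    split_ifs at hn with h
    · obtain ⟨k, rfl⟩ := h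
      exact ⟨k, rfl⟩
    · simp at hn
  rw [evalSum, ← hinj.tsum_eq hsup]
  simp only [coeff_expand_mul]

theorem isRestricted_expand {c : ℝ} (hc : 0 ≤ c) {f : K⟦X⟧}
    (hf : Tendsto (fun k => ‖coeff k f‖ * c ^ (2 * k)) atTop (𝓝 0)) :
    IsRestricted c (expand 2 two_ne_zero f) := by
  rw [isRestricted_iff']
  refine squeeze_zero (fun n => by positivity) (fun n => ?_)
    (hf.comp (Nat.tendsto_div_const_atTop two_ne_zero))
  rw [coeff_expand, Function.comp_apply]
  split_ifs with h
  · obtain ⟨k, rfl⟩ := h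
    rw [Nat.mul_div_cancel_left k two_pos]
  · rw [norm_zero, zero_mul]; positivity

variable [IsUltrametricDist K]

theorem isRestricted_expand_tail {z₀ : K} (hz₀ : z₀ ≠ 0) (h : WpConvergesAt g₂ g₃ z₀) :
    IsRestricted ‖z₀‖ (expand 2 two_ne_zero (tail g₂ g₃)) := by
  refine isRestricted_expand (norm_nonneg _) ?_
  have h0 := h.1.tendsto_cofinite_zero.norm
  rw [Nat.cofinite_eq_atTop, norm_zero] at h0
  have hn : ‖z₀‖ ≠ 0 := norm_ne_zero_iff.mpr hz₀
  have h1 := h0.const_mul (‖z₀‖ ^ 2)⁻¹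
  rw [mul_zero] at h1
  refine h1.congr fun k => ?_
  rw [norm_mul, norm_pow, tail, coeff_mk, pow_add]
  field_simp

variable {c : ℝ} {z : K}

theorem isRestricted_absSeries {a₂ a₄ : K} (h : IsRestricted c
    (expand 2 two_ne_zero (tail (modelG₂ a₂ a₄) (modelG₃ a₂ a₄)))) :
    IsRestricted c (absSeries a₂ a₄) := by
  rw [absSeries, wpSeries_eq]
  have hX : ∀ n, (X : K⟦X⟧) ^ n ∈ IsRestricted.subring (R := K) c := fun n =>
    (IsRestricted.subring (R := K) c).pow_mem isRestricted_X n
  exact (IsRestricted.subring (R := K) c).sub_mem (isRestricted.add c (isRestricted_one c)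
    (isRestricted.mul c (hX 4) h)) (isRestricted.mul c (isRestricted_C c _) (hX 2))

variable [CompleteSpace K]

theorem evalSum_C_add_X_pow_mul_expand {f : K⟦X⟧} (h : IsRestricted c (expand 2 two_ne_zero f))
    (hz : ‖z‖ ≤ c) (b : K) : evalSum z (C b + X ^ 4 * expand 2 two_ne_zero f) =
      b + z ^ 4 * ∑' k, coeff k f * z ^ (2 * k) := by
  have hX : IsRestricted c ((X : K⟦X⟧) ^ 4) :=
    (IsRestricted.subring (R := K) c).pow_mem isRestricted_X 4
  rw [evalSum_add (isRestricted_C c b) (isRestricted.mul c hX h) hz, evalSum_mul hX h hz,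
    evalSum_C, evalSum_X_pow, evalSum_expand]

variable {a₂ a₄ : K}

theorem wp_eq_absVal_add (h : IsRestricted c
    (expand 2 two_ne_zero (tail (modelG₂ a₂ a₄) (modelG₃ a₂ a₄)))) (hz : ‖z‖ ≤ c) (hz0 : z ≠ 0) :
    wp (modelG₂ a₂ a₄) (modelG₃ a₂ a₄) z = absVal a₂ a₄ z + a₂ / 3 := by
  have hX : IsRestricted c ((X : K⟦X⟧) ^ 2) :=
    (IsRestricted.subring (R := K) c).pow_mem isRestricted_X 2
  have hP : absSeries a₂ a₄ + C (a₂ / 3) * X ^ 2 =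
      C 1 + X ^ 4 * expand 2 two_ne_zero (tail (modelG₂ a₂ a₄) (modelG₃ a₂ a₄)) := by
    rw [absSeries, sub_add_cancel, wpSeries_eq, map_one]
  have e := congrArg (evalSum z) hP
  rw [evalSum_add (isRestricted_absSeries h) (isRestricted.mul c (isRestricted_C c _) hX) hz,
    evalSum_mul (isRestricted_C c _) hX hz, evalSum_C, evalSum_X_pow,
    evalSum_C_add_X_pow_mul_expand h hz] at e
  have hs : ∑' k, wpCoeff (modelG₂ a₂ a₄) (modelG₃ a₂ a₄) (k + 2) * z ^ (2 * k + 2) =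
      z ^ 2 * ∑' k, coeff k (tail (modelG₂ a₂ a₄) (modelG₃ a₂ a₄)) * z ^ (2 * k) := by
    rw [← tsum_mul_left]
    refine tsum_congr fun k => ?_
    rw [tail, coeff_mk, pow_add]; ring
  rw [wp, hs, absVal, eq_sub_of_add_eq e]
  field_simp
  ring

theorem wpDeriv_eq_two_mul_ordVal [CharZero K] (hc : 0 < c) (h : IsRestricted c
    (expand 2 two_ne_zero (tail (modelG₂ a₂ a₄) (modelG₃ a₂ a₄)))) (hz : ‖z‖ ≤ c) (hz0 : z ≠ 0) :
    wpDeriv (modelG₂ a₂ a₄) (modelG₃ a₂ a₄) z = 2 * ordVal a₂ a₄ z := by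
  have h' : IsRestricted c (expand 2 two_ne_zero (mk fun k => (2 * (k : K) + 2) *
      wpCoeff (modelG₂ a₂ a₄) (modelG₃ a₂ a₄) (k + 2))) := by
    rw [isRestricted_iff'] at h ⊢
    refine squeeze_zero (fun n => by positivity) (fun n => ?_) h
    gcongr
    rw [coeff_expand, coeff_expand]
    split_ifs with hn
    · rw [coeff_mk, tail, coeff_mk, norm_mul]
      refine mul_le_of_le_one_left (norm_nonneg _) ?_
      exact_mod_cast IsUltrametricDist.norm_natCast_le_one K (2 * (n / 2) + 2)
    · exact le_rfl
  have hs : ∑' k : ℕ, (2 * (k : K) + 2) * wpCoeff (modelG₂ a₂ a₄) (modelG₃ a₂ a₄) (k + 2) *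
      z ^ (2 * k + 1) = z * ∑' k, coeff k (mk fun k => (2 * (k : K) + 2) *
        wpCoeff (modelG₂ a₂ a₄) (modelG₃ a₂ a₄) (k + 2)) * z ^ (2 * k) := by
    rw [← tsum_mul_left]
    refine tsum_congr fun k => ?_
    rw [coeff_mk, pow_add]; ring
  rw [wpDeriv, hs, ordVal, ordSeries, wpDerivSeries_eq, evalSum_C_add_X_pow_mul_expand h' hz]
  field_simp

end Link

end WeierstrassSeries

namespace Edwards

open WeierstrassSeries PowerSeries

variable {K : Type*} [NormedField K] [IsUltrametricDist K] [CompleteSpace K] [CharZero K]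
  {d x₁ y₁ : K} [Fact (¬ IsSquare d)] {c : ℝ} {u v z : K}

theorem one_sub_ne_zero_of_not_isSquare {K : Type*} [Field K] {d : K} [Fact (¬ IsSquare d)] :
    1 - d ≠ 0 := fun h =>
  (Fact.out : ¬ IsSquare d) ⟨1, by linear_combination -h⟩

theorem ordVal_ne_zero (hx₁ : x₁ ≠ 0) (hc : 0 < c)
    (h : IsRestricted c (absSeries (a' d x₁) (b' d x₁))) (hz : ‖z‖ ≤ c) (hz0 : z ≠ 0) :
    ordVal (a' d x₁) (b' d x₁) z ≠ 0 := by
  intro h0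
  have hsq := ordVal_sq hc h hz hz0
  rw [h0, zero_pow two_ne_zero] at hsq
  exact absVal_ne_zero hc h hz hz0 (pow_ne_zero 2 hx₁)
    (EdwardsPoint.eq_zero_of_ordinate_eq_zero hx₁ one_sub_ne_zero_of_not_isSquare two_ne_zero hsq)

theorem absVal_add_x₁_ne_zero (hx₁ : x₁ ≠ 0) (hy₁ : y₁ ^ 2 = 4 * x₁ ^ 3 / (1 - d)) (hc : 0 < c)
    (h : IsRestricted c (absSeries (a' d x₁) (b' d x₁))) (hz : ‖z‖ ≤ c) (hz0 : z ≠ 0) :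
    absVal (a' d x₁) (b' d x₁) z + x₁ ≠ 0 :=
  EdwardsPoint.add_x₁_ne_zero hx₁ one_sub_ne_zero_of_not_isSquare two_ne_zero hy₁
    (ordVal_sq hc h hz hz0)

/-- Equality of abscissas would make the chord formulas for `u + v` and `u - v` degenerate, and so
force the ordinates at `u` to vanish. -/
theorem absVal_ne_absVal (hx₁ : x₁ ≠ 0) (hc : 0 < c)
    (h : IsRestricted c (absSeries (a' d x₁) (b' d x₁))) (hu : ‖u‖ ≤ c) (hv : ‖v‖ ≤ c)
    (hu0 : u ≠ 0) (hv0 : v ≠ 0) (huv : u + v ≠ 0) (huv' : u ≠ v) :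
    absVal (a' d x₁) (b' d x₁) u ≠ absVal (a' d x₁) (b' d x₁) v := by
  intro he
  have h1 := (absVal_add hc h hu hv hu0 hv0 huv).1
  have h2 := (absVal_add hc h hu (by rwa [norm_neg]) hu0 (neg_ne_zero.mpr hv0)
    (by rwa [← sub_eq_add_neg, sub_ne_zero])).1
  rw [absVal_neg, ordVal_neg, he, sub_self] at h2
  rw [he, sub_self] at h1
  simp only [ne_eq, OfNat.ofNat_ne_zero, not_false_eq_true, zero_pow, zero_mul] at h1 h2
  have e1 := pow_eq_zero_iff two_ne_zero |>.mp h1.symm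
  have e2 := pow_eq_zero_iff two_ne_zero |>.mp h2.symm
  have e3 : 2 * ordVal (a' d x₁) (b' d x₁) u = 0 := by linear_combination e1 + e2
  exact ordVal_ne_zero hx₁ hc h hu hu0 ((mul_eq_zero.mp e3).resolve_left two_ne_zero)

open Classical in
/-- The point `β(X(z), Y(z))` of the Edwards curve for `z ≠ 0` in a closed disc on which the series
converge, completed by the neutral point elsewhere. -/
noncomputable def expPoint (hx₁ : x₁ ≠ 0) (hy₁ : y₁ ^ 2 = 4 * x₁ ^ 3 / (1 - d)) (hc : 0 < c)
    (h : IsRestricted c (absSeries (a' d x₁) (b' d x₁))) (z : K) : EdwardsPoint d :=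
  if hz : z ≠ 0 ∧ ‖z‖ ≤ c then
    EdwardsPoint.ofModel hx₁ one_sub_ne_zero_of_not_isSquare hy₁ (ordVal_sq hc h hz.2 hz.1)
      (ordVal_ne_zero hx₁ hc h hz.2 hz.1) (absVal_add_x₁_ne_zero hx₁ hy₁ hc h hz.2 hz.1)
  else 0

section ExpPoint

variable (hx₁ : x₁ ≠ 0) (hy₁ : y₁ ^ 2 = 4 * x₁ ^ 3 / (1 - d)) (hc : 0 < c)
    (h : IsRestricted c (absSeries (a' d x₁) (b' d x₁)))

theorem expPoint_zero : expPoint hx₁ hy₁ hc h 0 = 0 := dif_neg (by simp)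

theorem expPoint_of_ne_zero (hz0 : z ≠ 0) (hz : ‖z‖ ≤ c) : expPoint hx₁ hy₁ hc h z =
    EdwardsPoint.ofModel hx₁ one_sub_ne_zero_of_not_isSquare hy₁ (ordVal_sq hc h hz hz0)
      (ordVal_ne_zero hx₁ hc h hz hz0) (absVal_add_x₁_ne_zero hx₁ hy₁ hc h hz hz0) :=
  dif_pos ⟨hz0, hz⟩

theorem expPoint_neg (hz : ‖z‖ ≤ c) :
    expPoint hx₁ hy₁ hc h (-z) = -expPoint hx₁ hy₁ hc h z := by
  by_cases hz0 : z = 0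
  · rw [hz0, neg_zero, expPoint_zero, neg_zero]
  rw [expPoint_of_ne_zero hx₁ hy₁ hc h (neg_ne_zero.mpr hz0) (by rwa [norm_neg]),
    expPoint_of_ne_zero hx₁ hy₁ hc h hz0 hz]
  ext
  · rw [EdwardsPoint.neg_x]
    simp only [EdwardsPoint.ofModel, absVal_neg, ordVal_neg, mul_neg, div_neg]
  · rw [EdwardsPoint.neg_y]
    simp only [EdwardsPoint.ofModel, absVal_neg]

theorem expPoint_add_of_ne (hu : ‖u‖ ≤ c) (hv : ‖v‖ ≤ c) (hu0 : u ≠ 0) (hv0 : v ≠ 0)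
    (huv : u + v ≠ 0) (huv' : u ≠ v) :
    expPoint hx₁ hy₁ hc h (u + v) = expPoint hx₁ hy₁ hc h u + expPoint hx₁ hy₁ hc h v := by
  have huvc : ‖u + v‖ ≤ c := (IsUltrametricDist.norm_add_le_max u v).trans (max_le hu hv)
  rw [expPoint_of_ne_zero hx₁ hy₁ hc h huv huvc, expPoint_of_ne_zero hx₁ hy₁ hc h hu0 hu,
    expPoint_of_ne_zero hx₁ hy₁ hc h hv0 hv]
  obtain ⟨h1, h2⟩ := absVal_add hc h hu hv hu0 hv0 huv
  exact EdwardsPoint.ofModel_add hx₁ _ hy₁ _ _ _ _ _ _ _ _ _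
    (absVal_ne_absVal hx₁ hc h hu hv hu0 hv0 huv huv') h1 h2

/-- The chord formulas do not cover `u = v`; the duplication formula follows from them by means of
`-v = v + (-2 v)`. -/
theorem expPoint_add (hu : ‖u‖ ≤ c) (hv : ‖v‖ ≤ c) :
    expPoint hx₁ hy₁ hc h (u + v) = expPoint hx₁ hy₁ hc h u + expPoint hx₁ hy₁ hc h v := by
  by_cases hu0 : u = 0
  · rw [hu0, zero_add, expPoint_zero, zero_add]
  by_cases hv0 : v = 0
  · rw [hv0, add_zero, expPoint_zero, add_zero]
  by_cases huv : u + v = 0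
  · rw [huv, expPoint_zero, eq_neg_of_add_eq_zero_left huv, expPoint_neg hx₁ hy₁ hc h hv,
      neg_add_cancel]
  by_cases huv' : u = v
  · subst huv'
    have h2 : ‖u + u‖ ≤ c := (IsUltrametricDist.norm_add_le_max u u).trans (max_le hu hu)
    have h3 : u ≠ -(u + u) := fun h3 => by
      have : 3 * u = 0 := by linear_combination h3
      exact hu0 ((mul_eq_zero.mp this).resolve_left three_ne_zero)
    have := expPoint_add_of_ne hx₁ hy₁ hc h hu (v := -(u + u)) (by rwa [norm_neg]) hu0
      (neg_ne_zero.mpr huv) (by simpa using hu0) h3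
    rw [show u + -(u + u) = -u by ring, expPoint_neg hx₁ hy₁ hc h hu,
      expPoint_neg hx₁ hy₁ hc h h2] at this
    rw [neg_eq_iff_add_eq_zero, ← add_assoc, ← sub_eq_add_neg, sub_eq_zero] at this
    exact this.symm
  · exact expPoint_add_of_ne hx₁ hy₁ hc h hu hv hu0 hv0 huv huv'

theorem expPoint_eq_zero_iff (hz : ‖z‖ ≤ c) : expPoint hx₁ hy₁ hc h z = 0 ↔ z = 0 := by
  refine ⟨fun h0 => ?_, fun h0 => by rw [h0, expPoint_zero]⟩
  by_contra hz0
  have hX := absVal_add_x₁_ne_zero hx₁ hy₁ hc h hz hz0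
  rw [expPoint_of_ne_zero hx₁ hy₁ hc h hz0 hz] at h0
  have hy := congrArg EdwardsPoint.y h0
  rw [EdwardsPoint.zero_y] at hy
  simp only [EdwardsPoint.ofModel] at hy
  rw [div_eq_one_iff_eq hX] at hy
  have : 2 * x₁ = 0 := by linear_combination -hy
  exact hx₁ ((mul_eq_zero.mp this).resolve_left two_ne_zero)

end ExpPoint

section Values

variable {K : Type*} [NormedField K] [IsUltrametricDist K] [CompleteSpace K] {d x₁ y₁ : K}
  {c : ℝ} {z : K}

theorem p_eq (ht : IsRestricted c (expand 2 two_ne_zero (tail (g₂ d x₁) (g₃ d x₁))))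
    (hz : ‖z‖ ≤ c) (hz0 : z ≠ 0) :
    p d x₁ z = absVal (a' d x₁) (b' d x₁) z + a' d x₁ / 3 := wp_eq_absVal_add ht hz hz0

theorem p'_eq [CharZero K]
    (ht : IsRestricted c (expand 2 two_ne_zero (tail (g₂ d x₁) (g₃ d x₁)))) (hc : 0 < c)
    (hz : ‖z‖ ≤ c) (hz0 : z ≠ 0) : p' d x₁ z = 2 * ordVal (a' d x₁) (b' d x₁) z :=
  wpDeriv_eq_two_mul_ordVal hc ht hz hz0

theorem beta_chi_expW [CharZero K]
    (ht : IsRestricted c (expand 2 two_ne_zero (tail (g₂ d x₁) (g₃ d x₁)))) (hc : 0 < c)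
    (hz : ‖z‖ ≤ c) (hz0 : z ≠ 0) : beta x₁ y₁ (chi d x₁ (expW d x₁ z)) =
      (y₁ * absVal (a' d x₁) (b' d x₁) z / (x₁ * ordVal (a' d x₁) (b' d x₁) z),
        (absVal (a' d x₁) (b' d x₁) z - x₁) / (absVal (a' d x₁) (b' d x₁) z + x₁)) := by
  simp only [beta, chi, expW, p_eq ht hz hz0, p'_eq ht hc hz hz0, add_sub_cancel_right]
  rw [one_div, inv_mul_cancel_left₀ two_ne_zero]

theorem expE_of_ne_zero [CharZero K]
    (ht : IsRestricted c (expand 2 two_ne_zero (tail (g₂ d x₁) (g₃ d x₁)))) (hc : 0 < c)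
    (hz : ‖z‖ ≤ c) (hz0 : z ≠ 0) : expE d x₁ y₁ z =
      (y₁ * absVal (a' d x₁) (b' d x₁) z / (x₁ * ordVal (a' d x₁) (b' d x₁) z),
        (absVal (a' d x₁) (b' d x₁) z - x₁) / (absVal (a' d x₁) (b' d x₁) z + x₁)) := by
  simp only [expE, if_neg hz0, p_eq ht hz hz0, p'_eq ht hc hz hz0]
  generalize absVal (a' d x₁) (b' d x₁) z = X
  generalize ordVal (a' d x₁) (b' d x₁) z = Y
  have h3 : 3 * (X + a' d x₁ / 3) - a' d x₁ = 3 * X := by ring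
  rw [h3, ← mul_sub, ← mul_add, mul_div_mul_left _ _ three_ne_zero]
  congr 1
  ring

theorem coe_expPoint [CharZero K] [Fact (¬ IsSquare d)] (hx₁ : x₁ ≠ 0)
    (hy₁ : y₁ ^ 2 = 4 * x₁ ^ 3 / (1 - d)) (hc : 0 < c)
    (ht : IsRestricted c (expand 2 two_ne_zero (tail (g₂ d x₁) (g₃ d x₁))))
    (h : IsRestricted c (absSeries (a' d x₁) (b' d x₁))) (hz : ‖z‖ ≤ c) :
    ((expPoint hx₁ hy₁ hc h z).x, (expPoint hx₁ hy₁ hc h z).y) = expE d x₁ y₁ z := by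
  by_cases hz0 : z = 0
  · subst hz0
    rw [expPoint_zero, EdwardsPoint.zero_x, EdwardsPoint.zero_y, expE, if_pos rfl]
  · rw [expPoint_of_ne_zero hx₁ hy₁ hc h hz0 hz, expE_of_ne_zero ht hc hz hz0]
    rfl

theorem exp_properties_of_ne_zero [CharZero K] [Fact (¬ IsSquare d)] (hx₁ : x₁ ≠ 0)
    (hy₁ : y₁ ^ 2 = 4 * x₁ ^ 3 / (1 - d)) (hc : 0 < c)
    (ht : IsRestricted c (expand 2 two_ne_zero (tail (g₂ d x₁) (g₃ d x₁))))
    (hz : ‖z‖ ≤ c) (hz0 : z ≠ 0) :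
    p' d x₁ z ≠ 0 ∧ 3 * p d x₁ z - a' d x₁ + 3 * x₁ ≠ 0 ∧
      (expW d x₁ z).2 ^ 2 = (expW d x₁ z).1 ^ 3 + a d x₁ * (expW d x₁ z).1 + b d x₁ ∧
      expE d x₁ y₁ z = beta x₁ y₁ (chi d x₁ (expW d x₁ z)) := by
  have h : IsRestricted c (absSeries (a' d x₁) (b' d x₁)) := isRestricted_absSeries ht
  refine ⟨?_, ?_, ?_, (expE_of_ne_zero ht hc hz hz0).trans (beta_chi_expW ht hc hz hz0).symm⟩
  · rw [p'_eq ht hc hz hz0]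
    exact mul_ne_zero two_ne_zero (ordVal_ne_zero hx₁ hc h hz hz0)
  · rw [p_eq ht hz hz0]
    intro h0
    refine absVal_add_x₁_ne_zero hx₁ hy₁ hc h hz hz0 ?_
    refine mul_left_cancel₀ (three_ne_zero (α := K)) ?_
    rw [mul_zero, ← h0]
    ring
  · have hsq := ordVal_sq hc h hz hz0
    simp only [expW, p_eq ht hz hz0, p'_eq ht hc hz hz0, a, b]
    linear_combination hsq

end Values

end Edwards

/-! ### Local fields -/

namespace WeierstrassSeries

section Radius

variable {K : Type*} [NormedField K] [CharZero K] {p : ℕ}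

theorem exists_one_le_pow_eq_inv (hp : p.Prime) (hp1 : ‖(p : K)‖ < 1) :
    ∃ ρ : ℝ, 1 ≤ ρ ∧ ρ ^ (p - 1) = ‖(p : K)‖⁻¹ := by
  have hp0 : 0 < ‖(p : K)‖ := by simpa using hp.ne_zero
  have h1 : 1 ≤ ‖(p : K)‖⁻¹ := (one_le_inv₀ hp0).mpr hp1.le
  refine ⟨‖(p : K)‖⁻¹ ^ (1 / ((p - 1 : ℕ) : ℝ)), Real.one_le_rpow h1 (by positivity), ?_⟩
  have : ((p - 1 : ℕ) : ℝ) ≠ 0 := by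
    have := hp.two_le
    exact_mod_cast (by omega : p - 1 ≠ 0)
  rw [← Real.rpow_natCast, ← Real.rpow_mul (by positivity), one_div_mul_cancel this, Real.rpow_one]

variable [IsUltrametricDist K] [CompleteSpace K]

/-- The series converge on some disc around `0`. -/
theorem exists_forall_norm_lt_wpConvergesAt (hp : p.Prime) (hp1 : ‖(p : K)‖ < 1) (a₂ a₄ : K) :
    ∃ ε > 0, ∀ z : K, ‖z‖ < ε → WpConvergesAt (modelG₂ a₂ a₄) (modelG₃ a₂ a₄) z := by
  obtain ⟨ρ, hρ, hρp⟩ := exists_one_le_pow_eq_inv hp hp1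
  have hμ1 : 1 ≤ max 1 (max ‖a₂‖ ‖a₄‖) := le_max_left _ _
  set μ := max 1 (max ‖a₂‖ ‖a₄‖)
  have h₂ : ‖a₂‖ ≤ μ := (le_max_left _ _).trans (le_max_right _ _)
  have h₄ : ‖a₄‖ ≤ μ := (le_max_right _ _).trans (le_max_right _ _)
  refine ⟨(μ * ρ)⁻¹, by positivity, fun z hz => wpConvergesAt_of_norm_lt (μ := μ) (ρ := ρ)
    (by positivity) (h₂.trans (le_self_pow₀ hμ1 two_ne_zero))
    (h₄.trans (le_self_pow₀ hμ1 four_ne_zero)) hρ (one_le_pow_mul_norm_factorial hp hp1 hρ hρp) ?_⟩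
  rwa [mul_comm, ← lt_div_iff₀ (by positivity), one_div]

/-- For an integral model the series converge on the disc `‖z‖ < ‖p‖ ^ (1 / (p - 1))`, on which
the exponential of any formal group over the ring of integers converges. -/
theorem wpConvergesAt_of_pow_lt (hp : p.Prime) (hp1 : ‖(p : K)‖ < 1) {a₂ a₄ : K} (h₂ : ‖a₂‖ ≤ 1)
    (h₄ : ‖a₄‖ ≤ 1) {z : K} (hz : ‖z‖ ^ (p - 1) < ‖(p : K)‖) :
    WpConvergesAt (modelG₂ a₂ a₄) (modelG₃ a₂ a₄) z := by
  obtain ⟨ρ, hρ, hρp⟩ := exists_one_le_pow_eq_inv hp hp1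
  refine wpConvergesAt_of_norm_lt (μ := 1) (ρ := ρ) one_pos (by simpa using h₂) (by simpa using h₄)
    hρ (one_le_pow_mul_norm_factorial hp hp1 hρ hρp) ?_
  have hp0 : 0 < ‖(p : K)‖ := by simpa using hp.ne_zero
  have := hp.two_le
  rw [one_mul, ← pow_lt_one_iff_of_nonneg (by positivity) (by omega : p - 1 ≠ 0), mul_pow, hρp,
    inv_mul_lt_one₀ hp0]
  exact hz

end Radius

end WeierstrassSeries

namespace Edwards

open WeierstrassSeries

variable {K : Type*} [Field K] [ValuativeRel K]

theorem mem_span_singleton_iff_valuation_le (z w : 𝒪[K]) :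
    z ∈ Ideal.span {w} ↔ valuation K z ≤ valuation K w :=
  Ideal.mem_span_singleton.trans (Valuation.integer.integers (valuation K)).le_iff_dvd.symm

variable [TopologicalSpace K] [IsNonarchimedeanLocalField K]

theorem prime_ringChar_residueField : (ringChar 𝓀[K]).Prime := by
  have := ringChar.charP 𝓀[K]
  exact (CharP.char_is_prime_or_zero 𝓀[K] (ringChar 𝓀[K])).resolve_right
    (CharP.char_ne_zero_of_finite 𝓀[K] (ringChar 𝓀[K]))

theorem valuation_ringChar_lt_one : valuation K ((ringChar 𝓀[K] : ℕ) : K) < 1 := by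
  have h : ((ringChar 𝓀[K] : ℕ) : 𝒪[K]) ∈ 𝓂[K] := by
    rw [← IsLocalRing.residue_eq_zero_iff, map_natCast, ringChar.Nat.cast_ringChar]
  have := Valuation.Integer.not_isUnit_iff_valuation_lt_one.mp
    ((IsLocalRing.mem_maximalIdeal _).mp h)
  simpa using this

/-- The exponential map on the disc of a point `z₀` of convergence. Over a
non-archimedean field the series converge on the whole closed disc `|z| ≤ |z₀|`, since their terms
tend to `0` at `z₀`. The valuation of a local field has rank one, so it comes from a norm that
induces the given topology. -/
theorem exists_expPoint_of_wpConvergesAt [CharZero K] (d x₁ y₁ : K) [Fact (¬ IsSquare d)]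
    (hx₁ : x₁ ≠ 0) (hy₁ : y₁ ^ 2 = 4 * x₁ ^ 3 / (1 - d)) (z₀ : K) (hz₀ : z₀ ≠ 0)
    (hconv : WpConvergesAt (g₂ d x₁) (g₃ d x₁) z₀) :
    ∃ E : K → EdwardsPoint d, E 0 = 0 ∧
      (∀ u v, valuation K u ≤ valuation K z₀ → valuation K v ≤ valuation K z₀ →
        E (u + v) = E u + E v) ∧
      ∀ z, valuation K z ≤ valuation K z₀ → (E z = 0 → z = 0) ∧
        ((E z).x, (E z).y) = expE d x₁ y₁ z ∧ (z ≠ 0 →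
        p' d x₁ z ≠ 0 ∧ 3 * p d x₁ z - a' d x₁ + 3 * x₁ ≠ 0 ∧
        (expW d x₁ z).2 ^ 2 = (expW d x₁ z).1 ^ 3 + a d x₁ * (expW d x₁ z).1 + b d x₁ ∧
        expE d x₁ y₁ z = beta x₁ y₁ (chi d x₁ (expW d x₁ z))) := by
  let := IsTopologicalAddGroup.rightUniformSpace K
  have := isUniformAddGroup_of_addCommGroup (G := K)
  let : Valuation.RankOne (Valued.v : Valuation K (ValueGroupWithZero K)) :=
    inferInstanceAs (Valuation.RankOne (valuation K))
  let : NormedField K := Valued.toNormedField K (ValueGroupWithZero K)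
  have : IsUltrametricDist K := inferInstance
  have : CompleteSpace K := inferInstance
  have hle : ∀ x y : K, ‖x‖ ≤ ‖y‖ ↔ valuation K x ≤ valuation K y := fun x y =>
    Valued.toNormedField.norm_le_iff
  have hc : 0 < ‖z₀‖ := norm_pos_iff.mpr hz₀
  have ht := isRestricted_expand_tail hz₀ hconv
  have h : PowerSeries.IsRestricted ‖z₀‖ (absSeries (a' d x₁) (b' d x₁)) :=
    isRestricted_absSeries ht
  refine ⟨expPoint hx₁ hy₁ hc h, expPoint_zero hx₁ hy₁ hc h, fun u v hu hv =>
    expPoint_add hx₁ hy₁ hc h ((hle _ _).mpr hu) ((hle _ _).mpr hv), fun z hz => ?_⟩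
  rw [← hle] at hz
  exact ⟨(expPoint_eq_zero_iff hx₁ hy₁ hc h hz).mp, coe_expPoint hx₁ hy₁ hc ht h hz,
    exp_properties_of_ne_zero hx₁ hy₁ hc ht hz⟩

theorem exists_wpConvergesAt_of_mem_maximalIdeal_pow [CharZero K] (d x₁ : K) :
    ∃ n : ℕ, 1 ≤ n ∧ ∀ z ∈ 𝓂[K] ^ n, WpConvergesAt (g₂ d x₁) (g₃ d x₁) (z : K) := by
  let := IsTopologicalAddGroup.rightUniformSpace K
  have := isUniformAddGroup_of_addCommGroup (G := K)
  let : Valuation.RankOne (Valued.v : Valuation K (ValueGroupWithZero K)) :=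
    inferInstanceAs (Valuation.RankOne (valuation K))
  let : NormedField K := Valued.toNormedField K (ValueGroupWithZero K)
  have : IsUltrametricDist K := inferInstance
  have : CompleteSpace K := inferInstance
  have hle : ∀ x y : K, ‖x‖ ≤ ‖y‖ ↔ valuation K x ≤ valuation K y := fun x y =>
    Valued.toNormedField.norm_le_iff
  obtain ⟨ε, hε, h⟩ := exists_forall_norm_lt_wpConvergesAt prime_ringChar_residueField
    (Valued.toNormedField.norm_lt_one_iff.mpr (valuation_ringChar_lt_one (K := K)))
    (a' d x₁) (b' d x₁)
  obtain ⟨π, hπ⟩ := IsDiscreteValuationRing.exists_irreducible 𝒪[K]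
  have hπ1 : ‖(π : K)‖ < 1 :=
    Valued.toNormedField.norm_lt_one_iff.mpr (Valuation.integer.v_irreducible_lt_one hπ)
  obtain ⟨n, hn⟩ := exists_pow_lt_of_lt_one hε hπ1
  refine ⟨n + 1, by omega, fun z hz => h _ ?_⟩
  have hz := Ideal.pow_le_pow_right (Nat.le_succ n) hz
  rw [hπ.maximalIdeal_eq, Ideal.span_singleton_pow, mem_span_singleton_iff_valuation_le, ← hle]
    at hz
  refine hz.trans_lt ?_
  simpa using hn

theorem wpConvergesAt_of_mem_maximalIdeal [CharZero K] {d x₁ : K} (hd : valuation K d = 1)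
    (hd1 : valuation K (1 - d) = 1) (hx₁ : valuation K x₁ ≤ 1)
    (hp : ((ringChar 𝓀[K] : ℕ) : 𝒪[K]) ∉ 𝓂[K] ^ (ringChar 𝓀[K] - 1)) :
    ∀ z ∈ 𝓂[K], WpConvergesAt (g₂ d x₁) (g₃ d x₁) (z : K) := by
  intro z hz
  let := IsTopologicalAddGroup.rightUniformSpace K
  have := isUniformAddGroup_of_addCommGroup (G := K)
  let : Valuation.RankOne (Valued.v : Valuation K (ValueGroupWithZero K)) :=
    inferInstanceAs (Valuation.RankOne (valuation K))
  let : NormedField K := Valued.toNormedField K (ValueGroupWithZero K)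
  have : IsUltrametricDist K := inferInstance
  have : CompleteSpace K := inferInstance
  have hle : ∀ x y : K, ‖x‖ ≤ ‖y‖ ↔ valuation K x ≤ valuation K y := fun x y =>
    Valued.toNormedField.norm_le_iff
  have hle1 : ∀ x : K, ‖x‖ ≤ 1 ↔ valuation K x ≤ 1 := fun x =>
    Valued.toNormedField.norm_le_one_iff
  have hx : ‖x₁‖ ≤ 1 := (hle1 _).mpr hx₁
  have hd' : ‖(1 - d)‖ = 1 := by
    refine le_antisymm ((hle1 _).mpr hd1.le) ?_
    rw [← norm_one (α := K), hle, hd1, map_one]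
  have h1d : ‖1 + d‖ ≤ 1 := (IsUltrametricDist.norm_add_le_max 1 d).trans
    (max_le norm_one.le ((hle1 _).mpr hd.le))
  have h2 : ‖(2 : K)‖ ≤ 1 := by simpa using IsUltrametricDist.norm_natCast_le_one K 2
  obtain ⟨π, hπ⟩ := IsDiscreteValuationRing.exists_irreducible 𝒪[K]
  refine wpConvergesAt_of_pow_lt prime_ringChar_residueField
    (Valued.toNormedField.norm_lt_one_iff.mpr (valuation_ringChar_lt_one (K := K)))
    (a₂ := a' d x₁) (a₄ := b' d x₁) ?_ ?_ ?_
  · rw [a', norm_mul, norm_mul, norm_div, hd', div_one]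
    exact mul_le_one₀ (mul_le_one₀ h2 (norm_nonneg _) hx) (norm_nonneg _) h1d
  · rw [b', norm_pow]
    exact pow_le_one₀ (norm_nonneg _) hx
  · rw [hπ.maximalIdeal_eq, mem_span_singleton_iff_valuation_le, ← hle] at hz
    rw [hπ.maximalIdeal_eq, Ideal.span_singleton_pow, mem_span_singleton_iff_valuation_le, ← hle,
      not_le] at hp
    refine (pow_le_pow_left₀ (norm_nonneg _) hz _).trans_lt ?_
    simpa using hp

/-- A non-zero ideal of the valuation ring is principal, so it is a closed disc whose radius is the
norm of one of its points. -/
theorem exists_injective_hom [CharZero K] (d x₁ y₁ : K) [Fact (¬ IsSquare d)] (hx₁ : x₁ ≠ 0)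
    (hy₁ : y₁ ^ 2 = 4 * x₁ ^ 3 / (1 - d)) (I : Ideal 𝒪[K])
    (hI : ∀ z ∈ I, WpConvergesAt (g₂ d x₁) (g₃ d x₁) (z : K)) :
    (∀ z ∈ I, z ≠ 0 → p' d x₁ (z : K) ≠ 0 ∧ 3 * p d x₁ (z : K) - a' d x₁ + 3 * x₁ ≠ 0 ∧
      (expW d x₁ (z : K)).2 ^ 2 = (expW d x₁ (z : K)).1 ^ 3
        + a d x₁ * (expW d x₁ (z : K)).1 + b d x₁ ∧
      expE d x₁ y₁ (z : K) = beta x₁ y₁ (chi d x₁ (expW d x₁ (z : K)))) ∧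
    ∃ φ : I →+ EdwardsPoint d, Function.Injective φ ∧
      ∀ z : I, ((φ z).x, (φ z).y) = expE d x₁ y₁ ((z : 𝒪[K]) : K) := by
  obtain ⟨z₀, rfl⟩ := (IsPrincipalIdealRing.principal I).principal
  by_cases h0 : z₀ = 0
  · have h : ∀ z ∈ 𝒪[K] ∙ z₀, z = 0 := by simp [h0]
    refine ⟨fun z hz hz0 => absurd (h z hz) hz0, 0, fun u v _ => ?_, fun z => ?_⟩
    · exact Subtype.ext ((h u u.2).trans (h v v.2).symm)
    · rw [h z z.2, expE, if_pos (by simp)]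
      rfl
  obtain ⟨E, hE0, hadd, hE⟩ := exists_expPoint_of_wpConvergesAt d x₁ y₁ hx₁ hy₁ z₀
    (by simpa using h0) (hI z₀ (Submodule.mem_span_singleton_self z₀))
  have hmem : ∀ z ∈ 𝒪[K] ∙ z₀, valuation K (z : K) ≤ valuation K (z₀ : K) := fun z hz =>
    (mem_span_singleton_iff_valuation_le z z₀).mp hz
  refine ⟨fun z hz hz0 => (hE z (hmem z hz)).2.2 (by simpa using hz0),
    ⟨⟨fun z => E ((z : 𝒪[K]) : K), hE0⟩, fun u v => hadd _ _ (hmem u u.2) (hmem v v.2)⟩, ?_,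
    fun z => (hE _ (hmem z z.2)).2.1⟩
  refine (injective_iff_map_eq_zero _).mpr fun z hz => ?_
  exact Subtype.ext (Subtype.ext ((hE _ (hmem z z.2)).1 hz))

end Edwards

theorem theorem3p1 {K : Type*} [Field K] [CharZero K] [ValuativeRel K] [TopologicalSpace K]
    [IsNonarchimedeanLocalField K] (d x₁ y₁ : K) [Fact (¬ IsSquare d)] (hx₁ : x₁ ≠ 0)
    (hy₁ : y₁ ^ 2 = 4 * x₁ ^ 3 / (1 - d)) :
    -- on every ideal `I ⊆ 𝔪_K` on which the series converge (in particular on `𝔪_K` itself,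
    -- if they converge there), the explicit map is an injective homomorphism to the Edwards group
    (∀ I : Ideal 𝒪[K], I ≤ 𝓂[K] →
      (∀ z ∈ I, WpConvergesAt (Edwards.g₂ d x₁) (Edwards.g₃ d x₁) (z : K)) →
      (∀ z ∈ I, z ≠ 0 →
        Edwards.p' d x₁ (z : K) ≠ 0 ∧
        3 * Edwards.p d x₁ (z : K) - Edwards.a' d x₁ + 3 * x₁ ≠ 0 ∧
        (Edwards.expW d x₁ (z : K)).2 ^ 2 = (Edwards.expW d x₁ (z : K)).1 ^ 3
          + Edwards.a d x₁ * (Edwards.expW d x₁ (z : K)).1 + Edwards.b d x₁ ∧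
        Edwards.expE d x₁ y₁ (z : K) =
          Edwards.beta x₁ y₁ (Edwards.chi d x₁ (Edwards.expW d x₁ (z : K)))) ∧
      ∃ φ : I →+ EdwardsPoint d, Function.Injective φ ∧
        ∀ z : I, ((φ z).x, (φ z).y) = Edwards.expE d x₁ y₁ ((z : 𝒪[K]) : K)) ∧
    -- the series always converge on some neighbourhood `𝔪_K ^ n` of zero
    (∃ n : ℕ, 1 ≤ n ∧
      ∀ z ∈ 𝓂[K] ^ n, WpConvergesAt (Edwards.g₂ d x₁) (Edwards.g₃ d x₁) (z : K)) ∧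
    -- they converge on all of `𝔪_K` if the Edwards curve has non-singular reduction, `x₁` is
    -- integral, and the ramification index is less than `p - 1`, `p` the residue characteristic
    (valuation K d = 1 → valuation K (1 - d) = 1 → valuation K x₁ ≤ 1 →
      ((ringChar 𝓀[K] : ℕ) : 𝒪[K]) ∉ 𝓂[K] ^ (ringChar 𝓀[K] - 1) →
      ∀ z ∈ 𝓂[K], WpConvergesAt (Edwards.g₂ d x₁) (Edwards.g₃ d x₁) (z : K)) := by
  exact ⟨fun I _ hI => Edwards.exists_injective_hom d x₁ y₁ hx₁ hy₁ I hI,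
    Edwards.exists_wpConvergesAt_of_mem_maximalIdeal_pow d x₁,
    Edwards.wpConvergesAt_of_mem_maximalIdeal⟩
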